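/- On $\mathbb R^7$ with dual standard basis $e^1,\dots,e^7$ (and $e^{ijk}=e^i\wedge e^j\wedge e^k$) put, for $\epsilon\in\{-1,1\}$, $$\varphi_\epsilon=-\epsilon\,(e^{127}+e^{347})+e^{567}+e^{135}-e^{146}-e^{236}-e^{245}.$$ A three-form $\varphi$ on a seven-dimensional real Lie algebra $\mathfrak g$ is a $\mathrm G_2$-structure (resp. a $\mathrm G_2^*$-structure) if $\varphi=f^*\varphi_{-1}$ (resp. $\varphi=f^*\varphi_1$) for some linear isomorphism $f:\mathfrak g\to\mathbb R^7$; then $(f^{-1}(e_1),\dots,f^{-1}(e_7))$ is called an adapted basis. A $\mathrm G_2^*$-structure $\varphi$ induces the pseudo-Euclidean metric $g_\varphi$ for which adapted bases $(f_1,\dots,f_7)$ are orthonormal with $g_\varphi(f_i,f_i)=-1$ for $i\le 4$ and $g_\varphi(f_i,f_i)=1$ for $i\ge 5$; signatures are written (number of positive directions, number of negative directions). The structure is called calibrated if $d\varphi=0$, where $d$ is the derivation of $\Lambda^\bullet\mathfrak g^*$ with $(d\alpha)(X,Y)=-\alpha([X,Y])$ for $\alpha\in\mathfrak g^*$. **Theorem.**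 Let $\mathfrak g$ be a seven-dimensional real Lie algebra and let $\mathfrak u$ be a six-dimensional Abelian ideal of $\mathfrak g$ (so that $\mathfrak g$ is almost Abelian). (a) The following are equivalent: (i) $\mathfrak g$ admits a calibrated $\mathrm G_2$-structure. (ii) $\mathfrak g$ admits a calibrated $\mathrm G_2^*$-structure $\varphi$ such that $\mathfrak u$ has signature $(2,4)$ with respect to $g_\varphi$. (iii) For any $f_7\in\mathfrak g\setminus\mathfrak u$ there exist $A,B\in\mathfrak{sl}(3,\mathbb R)$ and an ordered basis of $\mathfrak u$ with respect to which $\mathrm{ad}(f_7)|_{\mathfrak u}$ has the matrix $\begin{pmatrix}A&B\\-B&A\end{pmatrix}$. (iv) For any $f_7\in\mathfrak g\setminus\mathfrak u$ the complex Jordan normal form of $\mathrm{ad}(f_7)|_{\mathfrak u}$ is, up to a permutation of the Jordan blocks, $\mathrm{diag}(J,\overline J)$ for some trace-free matrix $J\in\mathbb C^{3\times3}$ in complex Jordan normal form. (b) The following are equivalent: (i) $\mathfrak g$ admits a calibrated $\mathrm G_2^*$-structure $\varphi$ such that $\mathfrak u$ has signature $(3,3)$ with respect to $g_\varphi$. (ii)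 For any $f_7\in\mathfrak g\setminus\mathfrak u$ there exist $A,B\in\mathfrak{sl}(3,\mathbb R)$ and an ordered basis of $\mathfrak u$ with respect to which $\mathrm{ad}(f_7)|_{\mathfrak u}$ has the matrix $\mathrm{diag}(A,B)$. (iii) For any $f_7\in\mathfrak g\setminus\mathfrak u$ the complex Jordan normal form of $\mathrm{ad}(f_7)|_{\mathfrak u}$ is, up to a permutation of the Jordan blocks, $\mathrm{diag}(J_1,J_2)$ for some trace-free matrices $J_1,J_2\in\mathbb C^{3\times3}$ which are complex Jordan normal forms of real $3\times3$ matrices. (c) The following are equivalent: (i) $\mathfrak g$ admits a calibrated $\mathrm G_2^*$-structure $\varphi$ such that $\mathfrak u$ is degenerate with respect to $g_\varphi$. (ii) For any $f_7\in\mathfrak g\setminus\mathfrak u$ there exist $A\in\mathfrak{gl}(3,\mathbb R)$, $B\in\mathfrak{sl}(3,\mathbb R)$ and an ordered basis of $\mathfrak u$ with respect to which $\mathrm{ad}(f_7)|_{\mathfrak u}$ has the matrix $\begin{pmatrix}A&0\\B&A-\mathrm{tr}(A)I_3\end{pmatrix}$. -/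

import Mathlib

open scoped TensorProduct

namespace CalibratedG2

noncomputable section

/-! ### Model tensors on `ℝ⁷` (the indices `1, …, 7` are written `0, …, 6`) -/

/-- The three-form `eⁱ ∧ eʲ ∧ eᵏ` on `ℝⁿ`, whose value on `(v₀, v₁, v₂)` is the determinant of the
matrix of the coordinates `i, j, k` of `v₀, v₁, v₂`. -/
def coordForm {n : ℕ} (i j k : Fin n) : (Fin n → ℝ) [⋀^Fin 3]→ₗ[ℝ] ℝ :=
  (Matrix.detRowAlternating (n := Fin 3) (R := ℝ)).compLinearMap
    (LinearMap.funLeft ℝ ℝ ![i, j, k])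

theorem coordForm_apply {n : ℕ} (i j k : Fin n) (v : Fin 3 → Fin n → ℝ) :
    coordForm i j k v = (Matrix.of fun a b : Fin 3 => v a (![i, j, k] b)).det := rfl

/-- The model three-form
`φ_ε = -ε (e¹²⁷ + e³⁴⁷) + e⁵⁶⁷ + e¹³⁵ - e¹⁴⁶ - e²³⁶ - e²⁴⁵` on `ℝ⁷`, used for `ε = ±1`. -/
def modelForm (ε : ℝ) : (Fin 7 → ℝ) [⋀^Fin 3]→ₗ[ℝ] ℝ :=
  -(ε • (coordForm 0 1 6 + coordForm 2 3 6)) + coordForm 4 5 6 + coordForm 0 2 4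
    - coordForm 0 3 5 - coordForm 1 2 5 - coordForm 1 3 4

/-- The pseudo-Euclidean metric on `ℝ⁷` belonging to `φ_ε`: the standard basis is orthogonal,
its first four vectors have square `-ε`, and its last three vectors have square `1`. -/
def modelMetric (ε : ℝ) : LinearMap.BilinForm ℝ (Fin 7 → ℝ) :=
  Matrix.toBilin' (Matrix.diagonal ![-ε, -ε, -ε, -ε, 1, 1, 1])

section VectorSpace

variable {V : Type*} [AddCommGroup V] [Module ℝ V]

/-- An isomorphism `f : V ≃ ℝ⁷` is adapted to the three-form `φ` if `f^* φ_ε = φ`; equivalently,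
the preimage of the standard basis under `f` is an adapted basis. -/
def IsAdapted (ε : ℝ) (φ : V [⋀^Fin 3]→ₗ[ℝ] ℝ) (f : V ≃ₗ[ℝ] (Fin 7 → ℝ)) : Prop :=
  (modelForm ε).compLinearMap f.toLinearMap = φ

/-- `φ` has model three-form `φ_ε`. -/
def IsG2EpsStructure (ε : ℝ) (φ : V [⋀^Fin 3]→ₗ[ℝ] ℝ) : Prop :=
  ∃ f : V ≃ₗ[ℝ] (Fin 7 → ℝ), IsAdapted ε φ f

/-- A `G₂`-structure on `V`. -/
def IsG2Structure (φ : V [⋀^Fin 3]→ₗ[ℝ] ℝ) : Prop := IsG2EpsStructure (-1) φ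

/-- A `G₂*`-structure on `V`. -/
def IsG2StarStructure (φ : V [⋀^Fin 3]→ₗ[ℝ] ℝ) : Prop := IsG2EpsStructure 1 φ

/-- `g` is the pseudo-Euclidean metric induced by the `G₂*`-structure `φ`: an adapted basis
`(f₁, …, f₇)` of `φ` is orthonormal for `g`, with `g(fᵢ, fᵢ) = -1` for `i ≤ 4` and
`g(fᵢ, fᵢ) = 1` for `i ≥ 5`. Since the stabilizer of `φ_1` in `GL(7, ℝ)` is contained in the
isometry group of `modelMetric 1`, `g` does not depend on the adapted basis. -/
def IsG2StarMetric (φ : V [⋀^Fin 3]→ₗ[ℝ] ℝ) (g : LinearMap.BilinForm ℝ V) : Prop :=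
  ∃ f : V ≃ₗ[ℝ] (Fin 7 → ℝ), IsAdapted 1 φ f ∧
    g = (modelMetric 1).comp f.toLinearMap f.toLinearMap

/-- The subspace `W` has signature `(p, q)` with respect to the pseudo-Euclidean metric `g`:
the restriction of `g` to `W` is non-degenerate, a maximal positive definite subspace of `W` has
dimension `p` and a maximal negative definite one has dimension `q`. -/
def HasSignature (g : LinearMap.BilinForm ℝ V) (W : Submodule ℝ V) (p q : ℕ) : Prop :=
  (g.restrict W).Nondegenerate ∧
    sigPos (LinearMap.BilinMap.toQuadraticMap (g.restrict W)) = p ∧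
    sigNeg (LinearMap.BilinMap.toQuadraticMap (g.restrict W)) = q

/-- The subspace `W` is degenerate with respect to `g`. -/
def IsDegenerate (g : LinearMap.BilinForm ℝ V) (W : Submodule ℝ V) : Prop :=
  ¬ (g.restrict W).Nondegenerate

end VectorSpace

section LieAlgebra

variable {𝔤 : Type*} [LieRing 𝔤] [LieAlgebra ℝ 𝔤]

/-- The value `(dφ)(X, Y, Z, W)` of the exterior derivative of a three-form `φ` on a Lie algebra:
`d` is the derivation of the exterior algebra of `𝔤^*` with `(dα)(X, Y) = -α([X, Y])` for
one-forms `α`. -/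
def extDeriv (φ : 𝔤 [⋀^Fin 3]→ₗ[ℝ] ℝ) (X Y Z W : 𝔤) : ℝ :=
  -φ ![⁅X, Y⁆, Z, W] + φ ![⁅X, Z⁆, Y, W] - φ ![⁅X, W⁆, Y, Z]
    - φ ![⁅Y, Z⁆, X, W] + φ ![⁅Y, W⁆, X, Z] - φ ![⁅Z, W⁆, X, Y]

/-- `φ` is closed, `dφ = 0`. -/
def IsClosedForm (φ : 𝔤 [⋀^Fin 3]→ₗ[ℝ] ℝ) : Prop :=
  ∀ X Y Z W : 𝔤, extDeriv φ X Y Z W = 0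

/-- A calibrated `G₂`-structure on a Lie algebra. -/
def IsCalibratedG2 (φ : 𝔤 [⋀^Fin 3]→ₗ[ℝ] ℝ) : Prop :=
  IsG2Structure φ ∧ IsClosedForm φ

/-- A calibrated `G₂*`-structure on a Lie algebra. -/
def IsCalibratedG2Star (φ : 𝔤 [⋀^Fin 3]→ₗ[ℝ] ℝ) : Prop :=
  IsG2StarStructure φ ∧ IsClosedForm φ

end LieAlgebra

/-! ### Complex Jordan normal forms -/

/-- `M` is block diagonal with Jordan blocks (the ones on the superdiagonal) along its diagonal. -/
def IsJordanMatrix {n : ℕ} (M : Matrix (Fin n) (Fin n) ℂ) : Prop :=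
  (∀ i j : Fin n, j.val ≠ i.val → j.val ≠ i.val + 1 → M i j = 0) ∧
  (∀ i j : Fin n, j.val = i.val + 1 → M i j = 0 ∨ (M i j = 1 ∧ M i i = M j j))

/-- `M` is, up to a permutation of the Jordan blocks, the complex Jordan normal form of the real
endomorphism `T`: `M` is a Jordan matrix and represents the complexification of `T` in some
basis. -/
def IsComplexJordanForm {U : Type*} [AddCommGroup U] [Module ℝ U] {n : ℕ}
    (T : Module.End ℝ U) (M : Matrix (Fin n) (Fin n) ℂ) : Prop :=
  IsJordanMatrix M ∧
    ∃ b : Module.Basis (Fin n) ℂ (ℂ ⊗[ℝ] U), LinearMap.toMatrix b b (T.baseChange ℂ) = M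

/-- The `6 × 6` matrix `diag(J, K)`. -/
def diagSix (J K : Matrix (Fin 3) (Fin 3) ℂ) : Matrix (Fin 6) (Fin 6) ℂ :=
  Matrix.reindex (finSumFinEquiv (m := 3) (n := 3)) (finSumFinEquiv (m := 3) (n := 3))
    (Matrix.fromBlocks J 0 0 K)

/-- The real endomorphism `T` of a six-dimensional space has the transformation matrix `M`
(given in `3 × 3` blocks) with respect to some ordered basis. -/
def HasBlockMatrix {U : Type*} [AddCommGroup U] [Module ℝ U]
    (T : Module.End ℝ U) (M : Matrix (Fin 3 ⊕ Fin 3) (Fin 3 ⊕ Fin 3) ℝ) : Prop :=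
  ∃ b : Module.Basis (Fin 3 ⊕ Fin 3) ℝ U, LinearMap.toMatrix b b T = M

end

end CalibratedG2

/-! Since `𝔲` is Abelian of codimension one, `dφ = 0` says only that `T = ad(x)|_𝔲`, for one
(equivalently every) `x ∉ 𝔲`, acts trivially as a derivation on the three-form `ρ = φ|_𝔲`.
Everything is thus about the infinitesimal stabilizer of `ρ`.

Let `n ≠ 0` be `g`-normal to `𝔲` and let `J` be the cross product with `n` on `𝔲`. The double cross
product identity gives `J² = -g(n,n)`, and `J` can be moved between the slots of `ρ`. The commutator
`[T, J]` has the same symmetry, hence commutes with `J`, and this yields `T J² = J T J`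
(`commutator_mul_eq_zero`). The sign of `g(n,n)` decides the rest: if `g(n,n) > 0`, then `T` is
complex linear for the rescaled `J` and `ρ` is the real part of a complex volume form, so `T` is a
trace-free complex `3 × 3` matrix (`exists_complex_block`); if `g(n,n) < 0`, then `T` preserves the
two eigenspaces of `J`, on each of which `ρ` is a volume form (`exists_split_block`); if `g(n,n) =
0`, then `T` preserves `ker J = im J` and acts there as on the quotient, up to a scalar
(`exists_null_block`). For `G₂` the metric is definite, so only the first case occurs. For `G₂*` the
three cases are signature `(2,4)`, signature `(3,3)` and `𝔲` degenerate.

Conversely, explicit coordinates put the model form on a suitable hyperplane into each of the three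
normal forms, and a block matrix of the given shape annihilates it. The first normal form does not
involve `ε`, which is why `G₂` and signature `(2,4)` give the same algebras.

The Jordan form conditions follow from the existence of Jordan forms of complex `3 × 3` matrices and
from the descent of similarity from `ℂ` to `ℝ` (`isSimilar_of_map_ofReal`). -/

namespace CalibratedG2

/-! ### Three-forms, endomorphisms symmetric with respect to them, and derivations annihilating
them. -/

section Trilinear

variable {U : Type*} [AddCommGroup U] [Module ℝ U]

/-- An alternating three-form as an iterated linear map. -/
def tri (ρ : U [⋀^Fin 3]→ₗ[ℝ] ℝ) : U →ₗ[ℝ] U →ₗ[ℝ] U →ₗ[ℝ] ℝ where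
  toFun x :=
    { toFun := fun y =>
        { toFun := fun z => ((ρ.curryLeft x).curryLeft y) ![z]
          map_add' := fun a b => AlternatingMap.map_vecCons_add _ _ _ _
          map_smul' := fun a b => AlternatingMap.map_vecCons_smul _ _ _ _ }
      map_add' := fun a b => by ext; simp
      map_smul' := fun a b => by ext; simp }
  map_add' a b := by ext; simp
  map_smul' a b := by ext; simp

variable (ρ : U [⋀^Fin 3]→ₗ[ℝ] ℝ)

theorem tri_apply (x y z : U) : tri ρ x y z = ρ ![x, y, z] := rfl

@[simp] theorem tri_self_left (x z : U) : tri ρ x x z = 0 :=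
  ρ.map_eq_zero_of_eq ![x, x, z] (i := 0) (j := 1) rfl (by decide)

@[simp] theorem tri_self_right (x z : U) : tri ρ x z z = 0 :=
  ρ.map_eq_zero_of_eq ![x, z, z] (i := 1) (j := 2) rfl (by decide)

@[simp] theorem tri_self_outer (x z : U) : tri ρ x z x = 0 :=
  ρ.map_eq_zero_of_eq ![x, z, x] (i := 0) (j := 2) rfl (by decide)

theorem tri_swap_left (x y z : U) : tri ρ y x z = - tri ρ x y z := by
  have h := tri_self_left ρ (x + y) z
  simp only [map_add, LinearMap.add_apply, tri_self_left] at h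
  linarith

theorem tri_swap_right (x y z : U) : tri ρ x z y = - tri ρ x y z := by
  have h := tri_self_right ρ x (y + z)
  simp only [map_add, LinearMap.add_apply, tri_self_right] at h
  linarith

theorem tri_rotate (x y z : U) : tri ρ y z x = tri ρ x y z := by
  rw [tri_swap_right, tri_swap_left]; ring

/-- `J` can be moved between the slots of `ρ`. -/
def IsRhoSymmetric (J : Module.End ℝ U) : Prop :=
  ∀ x y z, tri ρ (J x) y z = tri ρ x (J y) z

/-- `T` acts trivially on `ρ` as a derivation. -/
def Annihilates (T : Module.End ℝ U) : Prop :=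
  ∀ x y z, tri ρ (T x) y z + tri ρ x (T y) z + tri ρ x y (T z) = 0

/-- The only vector whose contraction with `ρ` vanishes is zero. -/
def IsNondegenerateForm : Prop := ∀ x, (∀ y z, tri ρ x y z = 0) → x = 0

variable {ρ} {J T : Module.End ℝ U}

theorem IsRhoSymmetric.mid (hJ : IsRhoSymmetric ρ J) (x y z : U) :
    tri ρ x (J y) z = tri ρ (J x) y z := (hJ x y z).symm

theorem IsRhoSymmetric.right (hJ : IsRhoSymmetric ρ J) (x y z : U) :
    tri ρ x y (J z) = tri ρ (J x) y z := by
  rw [tri_swap_right, hJ.mid, tri_swap_right, neg_neg]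

theorem IsRhoSymmetric.self_left (hJ : IsRhoSymmetric ρ J) (x z : U) :
    tri ρ (J x) x z = 0 := by
  have h := hJ x x z
  rw [tri_swap_left ρ (J x) x] at h
  linarith

theorem IsRhoSymmetric.swap_left (hJ : IsRhoSymmetric ρ J) (x y z : U) :
    tri ρ (J y) x z = - tri ρ (J x) y z := by
  rw [hJ y x z, tri_swap_left]

theorem IsRhoSymmetric.self_outer (hJ : IsRhoSymmetric ρ J) (x z : U) :
    tri ρ (J x) z x = 0 := by
  rw [tri_swap_right, hJ.self_left, neg_zero]

theorem IsRhoSymmetric.rotate (hJ : IsRhoSymmetric ρ J) (x y z : U) :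
    tri ρ (J y) z x = tri ρ (J x) y z := by
  rw [tri_swap_right, hJ.swap_left, neg_neg]

/-- This is the identity `ρ(Jx, y, z) = ρ(x, Jy, z)` differentiated along `T`. -/
theorem commutator_rhoSymmetric (hJ : IsRhoSymmetric ρ J) (hT : Annihilates ρ T) :
    IsRhoSymmetric ρ (T * J - J * T) := by
  intro x y z
  have h1 := hT (J x) y z
  have h2 := hT x (J y) z
  have e1 := hJ (T x) y z
  have e2 := hJ x (T y) z
  have e3 := hJ x y (T z)
  simp only [LinearMap.sub_apply, Module.End.mul_apply, map_sub]
  linarith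

/-- Two ρ-symmetric endomorphisms commute. Applied to `J` and `S = [T, J]`, this gives `[T, J] J =
0`: `T` commutes with `J` if `κ ≠ 0`, and `J T J = 0` if `κ = 0`. -/
theorem commutator_mul_eq_zero (hρ : IsNondegenerateForm ρ) (hJ : IsRhoSymmetric ρ J)
    (hT : Annihilates ρ T) {κ : ℝ} (hJ2 : ∀ x, J (J x) = κ • x) (x : U) :
    T (J (J x)) = J (T (J x)) := by
  have hS := commutator_rhoSymmetric hJ hT
  set S := T * J - J * T with hSdef
  have hcomm : ∀ x, S (J x) = J (S x) := by
    intro x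
    rw [← sub_eq_zero]
    apply hρ
    intro y z
    -- Three slots are needed: `S` is moved to the third and `J` to the second, so that they can
    -- return to the first in the other order.
    have h1 : tri ρ (S (J x)) y z = tri ρ (J (S x)) y z := by
      rw [← hS.right, hJ, hJ, ← hS.right x]
    rw [map_sub, LinearMap.sub_apply, LinearMap.sub_apply, h1, sub_self]
  have h := hcomm x
  simp only [hSdef, LinearMap.sub_apply, Module.End.mul_apply, map_sub, hJ2, map_smul] at h ⊢
  -- `S J = J S` reads `κ T - J T J = J T J - κ T`.
  have h2 : (2 : ℝ) • (κ • T x) = (2 : ℝ) • (J (T (J x))) := by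
    rw [two_smul, two_smul]
    calc κ • T x + κ • T x = (κ • T x - J (T (J x))) + (κ • T x + J (T (J x))) := by abel
      _ = (J (T (J x)) - κ • T x) + (κ • T x + J (T (J x))) := by rw [h]
      _ = _ := by abel
  exact smul_right_injective U (two_ne_zero' ℝ) h2

end Trilinear

/-! ### Frames consisting of three vectors and their images under `J`. -/

section Frames

variable {U : Type*} [AddCommGroup U] [Module ℝ U]
variable {ρ : U [⋀^Fin 3]→ₗ[ℝ] ℝ} {J T : Module.End ℝ U}

/-- Contracting a linear relation, and its image under `J`, with two of the `w i` isolates the two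
coefficients belonging to the third. They solve a homogeneous `2 × 2` system whose determinant is,
up to sign, the quantity assumed non-zero. -/
theorem linearIndependent_frame (hJ : IsRhoSymmetric ρ J) {κ : ℝ}
    (hJ2 : ∀ x, J (J x) = κ • x) (w : Fin 3 → U)
    (h : tri ρ (J (w 0)) (w 1) (w 2) ^ 2 - κ * tri ρ (w 0) (w 1) (w 2) ^ 2 ≠ 0) :
    LinearIndependent ℝ (Sum.elim w (J ∘ w)) := by
  rw [Fintype.linearIndependent_iff]
  intro g hg
  simp only [Fintype.sum_sum_type, Fin.sum_univ_three, Sum.elim_inl, Sum.elim_inr,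
    Function.comp_apply] at hg
  set r := tri ρ (w 0) (w 1) (w 2) with hr
  set r' := tri ρ (J (w 0)) (w 1) (w 2) with hr'
  have a0 := congrArg (fun u => tri ρ u (w 1) (w 2)) hg
  have b0 := congrArg (fun u => tri ρ (J u) (w 1) (w 2)) hg
  have a1 := congrArg (fun u => tri ρ u (w 2) (w 0)) hg
  have b1 := congrArg (fun u => tri ρ (J u) (w 2) (w 0)) hg
  have a2 := congrArg (fun u => tri ρ u (w 0) (w 1)) hg
  have b2 := congrArg (fun u => tri ρ (J u) (w 0) (w 1)) hg
  simp only [map_add, map_smul, map_zero, LinearMap.add_apply, LinearMap.smul_apply,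
    LinearMap.zero_apply, smul_eq_mul, tri_self_left, tri_self_outer, hJ.self_left,
    hJ.self_outer, hJ2, tri_rotate ρ (w 0) (w 1) (w 2), tri_rotate ρ (w 1) (w 2) (w 0),
    hJ.rotate (w 0) (w 1) (w 2), hJ.rotate (w 1) (w 2) (w 0), ← hr, ← hr'] at a0 b0 a1 b1 a2 b2
  have solve : ∀ a b : ℝ, a * r + b * r' = 0 → a * r' + b * (κ * r) = 0 → a = 0 ∧ b = 0 := by
    intro a b h1 h2
    constructor
    · exact (mul_eq_zero.mp (show a * (r' ^ 2 - κ * r ^ 2) = 0 by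
        linear_combination r' * h2 - κ * r * h1)).resolve_right h
    · exact (mul_eq_zero.mp (show b * (r' ^ 2 - κ * r ^ 2) = 0 by
        linear_combination r' * h1 - r * h2)).resolve_right h
  have c0 := solve (g (.inl 0)) (g (.inr 0)) (by linarith) (by linarith)
  have c1 := solve (g (.inl 1)) (g (.inr 1)) (by linarith) (by linarith)
  have c2 := solve (g (.inl 2)) (g (.inr 2)) (by linarith) (by linarith)
  rintro (i | i) <;> fin_cases i
  exacts [c0.1, c1.1, c2.1, c0.2, c1.2, c2.2]

end Frames

/-! ### Matrices of the derivations annihilating `ρ` in the three cases `J² = -1, 0, 1`. -/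

section BlockMatrices

variable {U : Type*} [AddCommGroup U] [Module ℝ U]
variable {ρ : U [⋀^Fin 3]→ₗ[ℝ] ℝ} {J T : Module.End ℝ U}

theorem hasBlockMatrix_of_frame (hU : Module.finrank ℝ U = 6) {v w : Fin 3 → U}
    (h : LinearIndependent ℝ (Sum.elim v w)) {A B C D : Matrix (Fin 3) (Fin 3) ℝ}
    (hv : ∀ j, T (v j) = ∑ i, A i j • v i + ∑ i, C i j • w i)
    (hw : ∀ j, T (w j) = ∑ i, B i j • v i + ∑ i, D i j • w i) :
    HasBlockMatrix T (Matrix.fromBlocks A B C D) := by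
  have hcard : Fintype.card (Fin 3 ⊕ Fin 3) = Module.finrank ℝ U := by rw [hU]; rfl
  refine ⟨basisOfLinearIndependentOfCardEqFinrank h hcard, ?_⟩
  set b := basisOfLinearIndependentOfCardEqFinrank h hcard
  have hb : ⇑b = Sum.elim v w := coe_basisOfLinearIndependentOfCardEqFinrank h hcard
  have hv' : ∀ i, v i = b (.inl i) := fun i => by rw [hb]; rfl
  have hw' : ∀ i, w i = b (.inr i) := fun i => by rw [hb]; rfl
  ext i j
  rw [LinearMap.toMatrix_apply]
  rcases j with j | j
  · rw [← hv', hv]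
    simp only [hv', hw', map_add, map_sum, map_smul, Module.Basis.repr_self]
    rcases i with i | i <;> simp [Finsupp.single_apply]
  · rw [← hw', hw]
    simp only [hv', hw', map_add, map_sum, map_smul, Module.Basis.repr_self]
    rcases i with i | i <;> simp [Finsupp.single_apply]

theorem exists_coords_of_frame (hU : Module.finrank ℝ U = 6) {v w : Fin 3 → U}
    (h : LinearIndependent ℝ (Sum.elim v w)) (T : Fin 3 → U) :
    ∃ A C : Matrix (Fin 3) (Fin 3) ℝ, ∀ j, T j = ∑ i, A i j • v i + ∑ i, C i j • w i := by
  have hcard : Fintype.card (Fin 3 ⊕ Fin 3) = Module.finrank ℝ U := by rw [hU]; rfl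
  set b := basisOfLinearIndependentOfCardEqFinrank h hcard
  have hb : ⇑b = Sum.elim v w := coe_basisOfLinearIndependentOfCardEqFinrank h hcard
  refine ⟨fun i j => b.repr (T j) (.inl i), fun i j => b.repr (T j) (.inr i), fun j => ?_⟩
  conv_lhs => rw [← b.sum_repr (T j)]
  rw [Fintype.sum_sum_type]
  simp [hb]

theorem IsNondegenerateForm.exists_tri_ne_zero (hρ : IsNondegenerateForm ρ) {x : U} (hx : x ≠ 0) :
    ∃ y z, tri ρ x y z ≠ 0 := by
  by_contra! h
  exact hx (hρ x h)

/-- `T` commutes with the complex structure `J`, so in a frame `w, Jw` it is the complex matrix `A +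
iC`. Its complex trace vanishes because `T` annihilates `ρ`. -/
theorem exists_complex_block (hU : Module.finrank ℝ U = 6) (hρ : IsNondegenerateForm ρ)
    (hJ : IsRhoSymmetric ρ J) (hJ2 : ∀ x, J (J x) = (-1 : ℝ) • x) (hT : Annihilates ρ T) :
    ∃ A B : Matrix (Fin 3) (Fin 3) ℝ, A.trace = 0 ∧ B.trace = 0 ∧
      HasBlockMatrix T (Matrix.fromBlocks A B (-B) A) := by
  have : Nontrivial U := Module.nontrivial_of_finrank_pos (R := ℝ) (by omega)
  obtain ⟨x, hx⟩ := exists_ne (0 : U)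
  obtain ⟨y, z, hxyz⟩ := hρ.exists_tri_ne_zero hx
  set w : Fin 3 → U := ![x, y, z]
  set r := tri ρ (w 0) (w 1) (w 2) with hr
  set r' := tri ρ (J (w 0)) (w 1) (w 2) with hr'
  have hr0 : r ≠ 0 := hxyz
  have hpos : r' ^ 2 - (-1) * r ^ 2 ≠ 0 := by
    have : 0 < r ^ 2 := by positivity
    nlinarith [sq_nonneg r']
  have hli := linearIndependent_frame hJ hJ2 w hpos
  obtain ⟨A, C, hAC⟩ := exists_coords_of_frame hU hli (fun j => T (w j))
  have hcomm : ∀ x, T (J x) = J (T x) := by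
    intro x
    have h := congrArg J (commutator_mul_eq_zero hρ hJ hT hJ2 x)
    rw [hJ2, hJ2, map_smul, map_smul, neg_one_smul, neg_one_smul, neg_inj] at h
    exact h.symm
  have hACJ : ∀ j, T (J (w j)) = ∑ i, (-C) i j • w i + ∑ i, A i j • (J ∘ w) i := by
    intro j
    rw [hcomm, hAC, map_add, map_sum, map_sum]
    simp only [map_smul, Function.comp_apply, hJ2]
    rw [add_comm]
    simp
  -- These two evaluations are the real and imaginary parts of `tr(A + iC) (r - i r') = 0`.
  have h1 := hT (w 0) (w 1) (w 2)
  have h2 := hT (J (w 0)) (w 1) (w 2)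
  rw [hcomm] at h2
  simp only [hAC, Fin.sum_univ_three, Function.comp_apply, map_add, map_smul, hJ2,
    LinearMap.add_apply, LinearMap.smul_apply, smul_eq_mul, tri_self_left, tri_self_right,
    tri_self_outer, hJ.mid, hJ.right, hJ.self_left, hJ.self_outer, ← hr, ← hr'] at h1 h2
  have e1 : A.trace * r + C.trace * r' = 0 := by
    rw [Matrix.trace_fin_three, Matrix.trace_fin_three]; linarith
  have e2 : A.trace * r' - C.trace * r = 0 := by
    rw [Matrix.trace_fin_three, Matrix.trace_fin_three]; linarith
  refine ⟨A, -C, ?_, ?_, ?_⟩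
  · exact (mul_eq_zero.mp (show A.trace * (r' ^ 2 - (-1) * r ^ 2) = 0 by
        linear_combination r * e1 + r' * e2)).resolve_right hpos
  · rw [Matrix.trace_neg, neg_eq_zero]
    exact (mul_eq_zero.mp (show C.trace * (r' ^ 2 - (-1) * r ^ 2) = 0 by
        linear_combination r' * e1 - r * e2)).resolve_right hpos
  · rw [neg_neg]
    exact hasBlockMatrix_of_frame hU hli hAC hACJ

/-- `J T J = 0` makes `T` block triangular in a frame `w, Jw`. The ρ-symmetry of `[T, J]` forces the
diagonal blocks `A` and `D` to differ by a scalar, and the annihilation of `ρ` identifies this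
scalar as `-tr A`. -/
theorem exists_null_block (hU : Module.finrank ℝ U = 6) (hρ : IsNondegenerateForm ρ)
    (hJ : IsRhoSymmetric ρ J) (hJ2 : ∀ x, J (J x) = (0 : ℝ) • x) (hJ0 : J ≠ 0)
    (hT : Annihilates ρ T) :
    ∃ A B : Matrix (Fin 3) (Fin 3) ℝ, B.trace = 0 ∧
      HasBlockMatrix T (Matrix.fromBlocks A 0 B (A - A.trace • (1 : Matrix (Fin 3) (Fin 3) ℝ))) := by
  obtain ⟨x, hx⟩ : ∃ x, J x ≠ 0 := by
    by_contra! h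
    exact hJ0 (LinearMap.ext h)
  obtain ⟨y, z, hxyz⟩ := hρ.exists_tri_ne_zero hx
  -- As `J² = 0`, subtracting a multiple of `J x` from `x` leaves `J x` unchanged; this multiple
  -- makes `ρ` vanish on the frame.
  set w : Fin 3 → U := ![x - (tri ρ x y z / tri ρ (J x) y z) • J x, y, z] with hw
  have hr : tri ρ (w 0) (w 1) (w 2) = 0 := by
    simp [hw, div_mul_cancel₀ _ hxyz]
  set r' := tri ρ (J (w 0)) (w 1) (w 2) with hr'
  have hr0 : r' ≠ 0 := by
    simpa [hr', hw, hJ2] using hxyz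
  have hpos : r' ^ 2 - 0 * tri ρ (w 0) (w 1) (w 2) ^ 2 ≠ 0 := by
    rw [hr]; simpa using hr0
  have hli := linearIndependent_frame hJ hJ2 w hpos
  obtain ⟨A, C, hAC⟩ := exists_coords_of_frame hU hli (fun j => T (w j))
  obtain ⟨B, D, hBD⟩ := exists_coords_of_frame hU hli (fun j => T (J (w j)))
  have hJTJ : ∀ x, J (T (J x)) = 0 := fun x => by
    rw [← commutator_mul_eq_zero hρ hJ hT hJ2, hJ2, zero_smul, map_zero]
  have hB : B = 0 := by
    ext i j
    have h := hJTJ (w j)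
    rw [hBD, map_add, map_sum, map_sum] at h
    simp only [map_smul, Function.comp_apply, hJ2, zero_smul, smul_zero, Finset.sum_const_zero,
      add_zero] at h
    have hliJ := Fintype.linearIndependent_iff.mp (hli.comp Sum.inr Sum.inr_injective)
      (fun i => B i j) (by simpa using h)
    exact hliJ i
  subst hB
  have hS := commutator_rhoSymmetric hJ hT
  have hSw : ∀ j, (T * J - J * T) (w j) = ∑ i, (D i j - A i j) • J (w i) := by
    intro j
    rw [LinearMap.sub_apply, Module.End.mul_apply, Module.End.mul_apply, hBD, hAC]
    simp only [map_add, map_sum, map_smul, Function.comp_apply, hJ2, sub_smul]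
    simp
  -- `s1`, `s2` equate the diagonal entries of `D - A`, and the `m`'s kill the off-diagonal ones.
  -- `t1` fixes the common diagonal entry, and `t0` gives `tr C = 0`.
  have s1 := hS (w 0) (w 1) (w 2)
  have s2 := hS.right (w 0) (w 1) (w 2)
  have n0 := fun z => hS.self_left (w 0) z
  have n1 := fun z => hS.self_left (w 1) z
  have n2 := fun z => hS.self_left (w 2) z
  have t0 := hT (w 0) (w 1) (w 2)
  have t1 := hT (J (w 0)) (w 1) (w 2)
  have m0 := n0 (w 1)
  have m0' := n0 (w 2)
  have m1 := n1 (w 0)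
  have m1' := n1 (w 2)
  have m2 := n2 (w 0)
  have m2' := n2 (w 1)
  have hrot : tri ρ (J (w 1)) (w 2) (w 0) = r' := hJ.rotate _ _ _
  have hrot' : tri ρ (J (w 2)) (w 0) (w 1) = r' := by rw [hJ.rotate, hrot]
  have sw0 : tri ρ (J (w 0)) (w 2) (w 1) = - r' := tri_swap_right _ _ _ _
  have sw1 : tri ρ (J (w 1)) (w 0) (w 2) = - r' := by rw [tri_swap_right, hrot]
  have sw2 : tri ρ (J (w 2)) (w 1) (w 0) = - r' := by rw [tri_swap_right, hrot']
  simp only [hSw, hAC, hBD, Fin.sum_univ_three, Function.comp_apply, map_add, map_smul, hJ2,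
    LinearMap.add_apply, LinearMap.smul_apply, smul_eq_mul, tri_self_left, tri_self_right,
    tri_self_outer, hJ.mid, hJ.right, hJ.self_left, hJ.self_outer, hr, ← hr', hrot, hrot', sw0,
    sw1, sw2, mul_zero, add_zero, zero_add, Matrix.zero_apply]
    at s1 s2 m0 m0' m1 m1' m2 m2' t0 t1
  have cancel : ∀ a b : ℝ, a * r' = b * r' → a = b := fun a b h => mul_right_cancel₀ hr0 h
  have q00 : D 0 0 + A 1 1 + A 2 2 = 0 := cancel _ _ (by linarith)
  have q11 : D 1 1 + A 0 0 + A 2 2 = 0 := cancel _ _ (by linarith)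
  have q22 : D 2 2 + A 0 0 + A 1 1 = 0 := cancel _ _ (by linarith)
  have q10 : D 1 0 = A 1 0 := cancel _ _ (by linarith)
  have q20 : D 2 0 = A 2 0 := cancel _ _ (by linarith)
  have q01 : D 0 1 = A 0 1 := cancel _ _ (by linarith)
  have q21 : D 2 1 = A 2 1 := cancel _ _ (by linarith)
  have q02 : D 0 2 = A 0 2 := cancel _ _ (by linarith)
  have q12 : D 1 2 = A 1 2 := cancel _ _ (by linarith)
  have hD : D = A - A.trace • (1 : Matrix (Fin 3) (Fin 3) ℝ) := by
    rw [Matrix.trace_fin_three]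
    ext i j
    fin_cases i <;> fin_cases j <;>
      simp only [Fin.zero_eta, Fin.mk_one, Fin.reduceFinMk, Matrix.sub_apply, Matrix.smul_apply,
        smul_eq_mul, Matrix.one_apply_eq, Matrix.one_apply_ne, ne_eq, Fin.reduceEq,
        not_false_eq_true, mul_zero, mul_one, sub_zero, one_ne_zero, zero_ne_one] <;> linarith
  refine ⟨A, C, ?_, ?_⟩
  · rw [Matrix.trace_fin_three]
    exact cancel _ _ (by linarith)
  · rw [← hD]
    exact hasBlockMatrix_of_frame hU hli hAC hBD

/-- `ρ` vanishes on any triple mixing the eigenspaces of `J`, hence is a sum of two volume forms.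
`T` commutes with `J`, preserves both eigenspaces, and must be trace-free on each. -/
theorem exists_split_block (hU : Module.finrank ℝ U = 6) (hρ : IsNondegenerateForm ρ)
    (hJ : IsRhoSymmetric ρ J) (hJ2 : ∀ x, J (J x) = (1 : ℝ) • x) (hJ1 : ∃ x, J x ≠ x)
    (hJ1' : ∃ x, J x ≠ -x) (hT : Annihilates ρ T) :
    ∃ A B : Matrix (Fin 3) (Fin 3) ℝ, A.trace = 0 ∧ B.trace = 0 ∧
      HasBlockMatrix T (Matrix.fromBlocks A 0 0 B) := by
  have hcomm : ∀ x, T (J x) = J (T x) := by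
    intro x
    have h := congrArg J (commutator_mul_eq_zero hρ hJ hT hJ2 x)
    rw [hJ2, hJ2, one_smul, one_smul] at h
    exact h.symm
  simp only [one_smul] at hJ2
  have hmix : ∀ s : ℝ, s ≠ 0 → ∀ x y z, J x = s • x → J y = -s • y → tri ρ x y z = 0 := by
    intro s hs x y z hx hy
    have h := hJ x y z
    simp only [hx, hy, map_smul, LinearMap.smul_apply, smul_eq_mul] at h
    exact (mul_eq_zero.mp (show (2 * s) * tri ρ x y z = 0 by linarith)).resolve_left (by simpa)
  -- `J v + s v` is twice `s` times the projection of `v` to the `s`-eigenspace. Once the first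
  -- argument lies in that eigenspace, projecting the other two does not destroy non-vanishing, by
  -- `hmix`.
  have hframe : ∀ s : ℝ, s * s = 1 → (∃ x, J x ≠ -s • x) →
      ∃ w : Fin 3 → U, (∀ i, J (w i) = s • w i) ∧ tri ρ (w 0) (w 1) (w 2) ≠ 0 := by
    rintro s hs ⟨x, hx⟩
    have hs0 : s ≠ 0 := by rintro rfl; simp at hs
    have hproj : ∀ x, J (J x + s • x) = s • (J x + s • x) := by
      intro x
      rw [map_add, map_smul, hJ2, smul_add, smul_smul, hs, one_smul, add_comm]
    have hproj' : ∀ x, J (J x - s • x) = -s • (J x - s • x) := by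
      intro x
      rw [map_sub, map_smul, hJ2, smul_sub, smul_smul, neg_mul, hs]
      module
    have hdec : ∀ y, (2 : ℝ) • y = s • (J y + s • y) - s • (J y - s • y) := by
      intro y
      rw [← smul_sub, add_sub_sub_cancel, ← two_smul ℝ (s • y), smul_smul, smul_smul]
      congr 1
      linear_combination -2 * hs
    have hx0 : J x + s • x ≠ 0 := by
      intro h
      exact hx (by rw [neg_smul]; exact eq_neg_of_add_eq_zero_left h)
    obtain ⟨y, z, hyz⟩ := hρ.exists_tri_ne_zero hx0
    refine ⟨![J x + s • x, J y + s • y, J z + s • z], ?_, ?_⟩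
    · intro i
      fin_cases i <;> exact hproj _
    · have e : ∀ v y z, J v = s • v → 2 * tri ρ v y z = s * tri ρ v (J y + s • y) z := by
        intro v y z hv
        have hb := hmix s hs0 v _ z hv (hproj' y)
        have h := congrArg (fun u => tri ρ v u z) (hdec y)
        generalize J y + s • y = a at h ⊢
        generalize J y - s • y = b at h hb
        simp only [map_sub, map_smul, LinearMap.sub_apply, LinearMap.smul_apply, smul_eq_mul,
          hb] at h
        linarith
      have e1 := e _ y z (hproj x)
      have e2 := e _ z (J y + s • y) (hproj x)
      rw [tri_swap_right, tri_swap_right ρ _ (J y + s • y) (J z + s • z)] at e2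
      intro h
      change tri ρ (J x + s • x) (J y + s • y) (J z + s • z) = 0 at h
      rw [h, neg_zero, mul_zero] at e2
      have e3 : tri ρ (J x + s • x) (J y + s • y) z = 0 := by linarith
      rw [e3, mul_zero] at e1
      exact hyz (by linarith)
  obtain ⟨p, hp, hp0⟩ := hframe 1 (by norm_num) (by simpa using hJ1')
  obtain ⟨q, hq, hq0⟩ := hframe (-1) (by norm_num) (by simpa using hJ1)
  have hpq : ∀ i j z, tri ρ (p i) (q j) z = 0 := fun i j z =>
    hmix 1 one_ne_zero _ _ _ (hp i) (hq j)
  have hqp : ∀ i j z, tri ρ (q i) (p j) z = 0 := fun i j z =>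
    hmix (-1) (by norm_num) _ _ _ (hq i) (by rw [hp, neg_neg])
  have hli : LinearIndependent ℝ (Sum.elim p q) := by
    rw [Fintype.linearIndependent_iff]
    intro g hg
    simp only [Fintype.sum_sum_type, Fin.sum_univ_three, Sum.elim_inl, Sum.elim_inr] at hg
    have ev := fun y z => congrArg (fun u => tri ρ u y z) hg
    simp only [map_add, map_smul, map_zero, LinearMap.add_apply, LinearMap.smul_apply,
      LinearMap.zero_apply, smul_eq_mul] at ev
    have a0 := ev (p 1) (p 2)
    have a1 := ev (p 2) (p 0)
    have a2 := ev (p 0) (p 1)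
    have b0 := ev (q 1) (q 2)
    have b1 := ev (q 2) (q 0)
    have b2 := ev (q 0) (q 1)
    simp only [hpq, hqp, tri_self_left, tri_self_outer, mul_zero, add_zero, zero_add,
      tri_rotate ρ (p 0) (p 1) (p 2), tri_rotate ρ (p 1) (p 2) (p 0),
      tri_rotate ρ (q 0) (q 1) (q 2), tri_rotate ρ (q 1) (q 2) (q 0), mul_eq_zero, hp0, hq0,
      or_false] at a0 a1 a2 b0 b1 b2
    rintro (i | i) <;> fin_cases i <;> assumption
  obtain ⟨A, C, hAC⟩ := exists_coords_of_frame hU hli (fun j => T (p j))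
  obtain ⟨B, D, hBD⟩ := exists_coords_of_frame hU hli (fun j => T (q j))
  have hC : C = 0 := by
    ext i j
    have h1 : J (T (p j)) = T (p j) := by rw [← hcomm, hp, one_smul]
    rw [hAC, map_add, map_sum, map_sum] at h1
    simp only [map_smul, hp, hq, one_smul, neg_smul, smul_neg, Finset.sum_neg_distrib] at h1
    have h2 : ∑ i, C i j • q i = 0 := by
      have h3 := add_left_cancel h1
      have h4 : (2 : ℝ) • ∑ i, C i j • q i = 0 := by
        rw [two_smul]; nth_rewrite 1 [← h3]; exact neg_add_cancel _
      exact (smul_eq_zero.mp h4).resolve_left two_ne_zero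
    exact Fintype.linearIndependent_iff.mp (hli.comp Sum.inr Sum.inr_injective)
      (fun i => C i j) (by simpa using h2) i
  have hB : B = 0 := by
    ext i j
    have h1 : J (T (q j)) = - T (q j) := by rw [← hcomm, hq, map_smul, neg_one_smul]
    rw [hBD, map_add, map_sum, map_sum, neg_add] at h1
    simp only [map_smul, hp, hq, one_smul, neg_smul, smul_neg, Finset.sum_neg_distrib] at h1
    have h2 : ∑ i, B i j • p i = 0 := by
      have h3 := add_right_cancel h1
      have h4 : (2 : ℝ) • ∑ i, B i j • p i = 0 := by
        rw [two_smul]; nth_rewrite 1 [h3]; exact neg_add_cancel _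
      exact (smul_eq_zero.mp h4).resolve_left two_ne_zero
    exact Fintype.linearIndependent_iff.mp (hli.comp Sum.inl Sum.inl_injective)
      (fun i => B i j) (by simpa using h2) i
  subst hB hC
  have tp := hT (p 0) (p 1) (p 2)
  have tq := hT (q 0) (q 1) (q 2)
  simp only [hAC, hBD, Fin.sum_univ_three, map_add, map_smul, LinearMap.add_apply,
    LinearMap.smul_apply, smul_eq_mul, tri_self_left, tri_self_right, tri_self_outer,
    Matrix.zero_apply, mul_zero, add_zero, zero_add, zero_smul] at tp tq
  refine ⟨A, D, ?_, ?_, hasBlockMatrix_of_frame hU hli hAC hBD⟩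
  · rw [Matrix.trace_fin_three]
    exact (mul_eq_zero.mp (by linarith)).resolve_right hp0
  · rw [Matrix.trace_fin_three]
    exact (mul_eq_zero.mp (by linarith)).resolve_right hq0

end BlockMatrices

/-! ### The cross product of the model and its identities, checked in coordinates. -/

section Model

theorem modelMetric_apply (ε : ℝ) (x y : Fin 7 → ℝ) :
    modelMetric ε x y = -ε * (x 0 * y 0 + x 1 * y 1 + x 2 * y 2 + x 3 * y 3)
      + x 4 * y 4 + x 5 * y 5 + x 6 * y 6 := by
  simp only [modelMetric, Matrix.toBilin'_apply', Matrix.mulVec_diagonal, dotProduct,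
    Fin.sum_univ_seven]
  simp
  ring

theorem coordForm_eq (i j k : Fin 7) (x y z : Fin 7 → ℝ) :
    coordForm i j k ![x, y, z] =
      (x i * y j - x j * y i) * z k - (x i * y k - x k * y i) * z j
        + (x j * y k - x k * y j) * z i := by
  rw [coordForm_apply, Matrix.det_fin_three]
  simp
  ring

theorem modelForm_eq (ε : ℝ) (x y z : Fin 7 → ℝ) :
    modelForm ε ![x, y, z] =
      -(ε * (coordForm 0 1 6 ![x, y, z] + coordForm 2 3 6 ![x, y, z])) + coordForm 4 5 6 ![x, y, z]
      + coordForm 0 2 4 ![x, y, z] - coordForm 0 3 5 ![x, y, z] - coordForm 1 2 5 ![x, y, z]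
      - coordForm 1 3 4 ![x, y, z] := rfl

/-- The map `x ↦ n × x` for the cross product of the model, given by
`g(n × x, y) = φ_ε(n, x, y)`. -/
def cross (ε : ℝ) (n : Fin 7 → ℝ) : Module.End ℝ (Fin 7 → ℝ) where
  toFun x :=
    ![-ε * (-ε * (n 1 * x 6 - n 6 * x 1) + (n 2 * x 4 - n 4 * x 2) - (n 3 * x 5 - n 5 * x 3)),
      -ε * (-ε * (n 6 * x 0 - n 0 * x 6) - (n 2 * x 5 - n 5 * x 2) - (n 3 * x 4 - n 4 * x 3)),
      -ε * (-ε * (n 3 * x 6 - n 6 * x 3) + (n 4 * x 0 - n 0 * x 4) - (n 5 * x 1 - n 1 * x 5)),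
      -ε * (-ε * (n 6 * x 2 - n 2 * x 6) - (n 5 * x 0 - n 0 * x 5) - (n 4 * x 1 - n 1 * x 4)),
      (n 5 * x 6 - n 6 * x 5) + (n 0 * x 2 - n 2 * x 0) - (n 1 * x 3 - n 3 * x 1),
      (n 6 * x 4 - n 4 * x 6) - (n 0 * x 3 - n 3 * x 0) - (n 1 * x 2 - n 2 * x 1),
      -ε * (n 0 * x 1 - n 1 * x 0) - ε * (n 2 * x 3 - n 3 * x 2) + (n 4 * x 5 - n 5 * x 4)]
  map_add' x y := by
    ext i; fin_cases i <;> simp <;> ring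
  map_smul' c x := by
    ext i; fin_cases i <;> simp <;> ring

theorem cross_apply (ε : ℝ) (n x : Fin 7 → ℝ) :
    cross ε n x 0 = -ε * (-ε * (n 1 * x 6 - n 6 * x 1) + (n 2 * x 4 - n 4 * x 2) - (n 3 * x 5 - n 5 * x 3)) ∧
    cross ε n x 1 = -ε * (-ε * (n 6 * x 0 - n 0 * x 6) - (n 2 * x 5 - n 5 * x 2) - (n 3 * x 4 - n 4 * x 3)) ∧
    cross ε n x 2 = -ε * (-ε * (n 3 * x 6 - n 6 * x 3) + (n 4 * x 0 - n 0 * x 4) - (n 5 * x 1 - n 1 * x 5)) ∧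
    cross ε n x 3 = -ε * (-ε * (n 6 * x 2 - n 2 * x 6) - (n 5 * x 0 - n 0 * x 5) - (n 4 * x 1 - n 1 * x 4)) ∧
    cross ε n x 4 = (n 5 * x 6 - n 6 * x 5) + (n 0 * x 2 - n 2 * x 0) - (n 1 * x 3 - n 3 * x 1) ∧
    cross ε n x 5 = (n 6 * x 4 - n 4 * x 6) - (n 0 * x 3 - n 3 * x 0) - (n 1 * x 2 - n 2 * x 1) ∧
    cross ε n x 6 = -ε * (n 0 * x 1 - n 1 * x 0) - ε * (n 2 * x 3 - n 3 * x 2) + (n 4 * x 5 - n 5 * x 4) :=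
  ⟨rfl, rfl, rfl, rfl, rfl, rfl, rfl⟩

theorem modelMetric_cross {ε : ℝ} (hε : ε = 1 ∨ ε = -1) (n x y : Fin 7 → ℝ) :
    modelMetric ε (cross ε n x) y = modelForm ε ![n, x, y] := by
  obtain ⟨h0, h1, h2, h3, h4, h5, h6⟩ := cross_apply ε n x
  rw [modelMetric_apply, modelForm_eq]
  simp only [coordForm_eq, h0, h1, h2, h3, h4, h5, h6]
  rcases hε with rfl | rfl <;> ring

theorem cross_cross {ε : ℝ} (hε : ε = 1 ∨ ε = -1) (n x : Fin 7 → ℝ) :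
    cross ε n (cross ε n x) = -modelMetric ε n n • x + modelMetric ε n x • n := by
  obtain ⟨h0, h1, h2, h3, h4, h5, h6⟩ := cross_apply ε n x
  obtain ⟨k0, k1, k2, k3, k4, k5, k6⟩ := cross_apply ε n (cross ε n x)
  rw [modelMetric_apply, modelMetric_apply]
  ext i
  rw [Pi.add_apply, Pi.smul_apply, Pi.smul_apply, smul_eq_mul, smul_eq_mul]
  rcases hε with rfl | rfl <;> fin_cases i <;>
    simp only [Fin.zero_eta, Fin.mk_one, Fin.reduceFinMk, k0, k1, k2, k3, k4, k5, k6,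
      h0, h1, h2, h3, h4, h5, h6] <;> ring

/-- The right-hand side vanishes when `x`, `y`, `z` are orthogonal to `n`: on the normal hyperplane
the cross product with `n` is ρ-symmetric. -/
theorem cross_rhoSymmetric {ε : ℝ} (hε : ε = 1 ∨ ε = -1) (n x y z : Fin 7 → ℝ) :
    modelForm ε ![cross ε n x, y, z] - modelForm ε ![x, cross ε n y, z] =
      modelMetric ε n y * modelMetric ε x z - 2 * modelMetric ε x y * modelMetric ε n z
        + modelMetric ε n x * modelMetric ε y z := by
  obtain ⟨h0, h1, h2, h3, h4, h5, h6⟩ := cross_apply ε n x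
  obtain ⟨k0, k1, k2, k3, k4, k5, k6⟩ := cross_apply ε n y
  simp only [modelMetric_apply, modelForm_eq, coordForm_eq, h0, h1, h2, h3, h4, h5, h6, k0, k1, k2,
    k3, k4, k5, k6]
  rcases hε with rfl | rfl <;> ring

/-- The contraction of `φ_ε` with a non-zero vector does not vanish on a hyperplane. -/
theorem modelForm_contraction {ε : ℝ} (hε : ε = 1 ∨ ε = -1) {x : Fin 7 → ℝ}
    {m : Fin 7 → ℝ} {W : Submodule ℝ (Fin 7 → ℝ)}
    (hm : ∀ v, ∃ t : ℝ, ∃ w ∈ W, v = t • m + w) (h : ∀ y ∈ W, ∀ z ∈ W, modelForm ε ![x, y, z] = 0) :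
    x = 0 := by
  -- A two-form vanishing on a hyperplane is decomposable, so the contraction of `φ_ε` with `x`
  -- satisfies the Plücker relations.
  have hpf : ∀ a b c d, modelForm ε ![x, a, b] * modelForm ε ![x, c, d]
      - modelForm ε ![x, a, c] * modelForm ε ![x, b, d]
      + modelForm ε ![x, a, d] * modelForm ε ![x, b, c] = 0 := by
    intro a b c d
    simp only [← tri_apply] at h ⊢
    obtain ⟨ta, a, ha, rfl⟩ := hm a
    obtain ⟨tb, b, hb, rfl⟩ := hm b
    obtain ⟨tc, c, hc, rfl⟩ := hm c
    obtain ⟨td, d, hd, rfl⟩ := hm d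
    simp only [map_add, map_smul, LinearMap.add_apply, LinearMap.smul_apply, smul_eq_mul,
      tri_self_right, h a ha b hb, h a ha c hc, h a ha d hd, h b hb c hc, h b hb d hd, h c hc d hd,
      tri_swap_right _ x m a,
      tri_swap_right _ x m b, tri_swap_right _ x m c]
    ring
  have e := fun a b c d : Fin 7 => hpf (Pi.single a 1) (Pi.single b 1) (Pi.single c 1)
    (Pi.single d 1)
  -- The quadruples are the complements of the seven triples occurring in `φ_ε`. Each relation is a
  -- signed sum of the squares of the coordinates of `x` in that triple, and the seven together
  -- force all squares to vanish.
  have e0 := e 2 3 4 5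
  have e1 := e 0 1 4 5
  have e2 := e 0 1 2 3
  have e3 := e 1 3 5 6
  have e4 := e 1 2 4 6
  have e5 := e 0 3 4 6
  have e6 := e 0 2 5 6
  simp only [modelForm_eq, coordForm_eq, Pi.single_apply, Fin.reduceEq, if_true, if_false, mul_zero,
    mul_one, sub_zero, zero_sub, add_zero, zero_add, neg_zero, neg_neg]
    at e0 e1 e2 e3 e4 e5 e6
  have hsq : ∀ i, x i ^ 2 = 0 := by
    intro i
    rcases hε with rfl | rfl <;> fin_cases i <;> simp only [Fin.zero_eta, Fin.mk_one, Fin.reduceFinMk] <;> linarith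
  ext i
  exact pow_eq_zero_iff two_ne_zero |>.mp (hsq i)

end Model

/-! ### The normal vector of a hyperplane and the endomorphism it induces. -/

section Hyperplane

variable {U : Type*} [AddCommGroup U] [Module ℝ U]

theorem modelMetric_symm (ε : ℝ) (x y : Fin 7 → ℝ) : modelMetric ε x y = modelMetric ε y x := by
  rw [modelMetric_apply, modelMetric_apply]; ring

/-- `n` spans the orthogonal complement of the image of `i`, and `J` is the cross product with `n`
on this image. -/
structure IsNormal (ε : ℝ) (i : U →ₗ[ℝ] (Fin 7 → ℝ)) (n : Fin 7 → ℝ) (J : Module.End ℝ U) :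
    Prop where
  ne_zero : n ≠ 0
  mem_iff : ∀ v, (∃ u, i u = v) ↔ modelMetric ε n v = 0
  cross_eq : ∀ u, i (J u) = cross ε n (i u)

theorem exists_isNormal {ε : ℝ} (hε : ε = 1 ∨ ε = -1) (hU : Module.finrank ℝ U = 6)
    {i : U →ₗ[ℝ] (Fin 7 → ℝ)} (hi : Function.Injective i) :
    ∃ n J, IsNormal ε i n J := by
  have hW : Module.finrank ℝ (LinearMap.range i) = 6 := by
    rw [LinearMap.finrank_range_of_inj hi, hU]
  have hlt : LinearMap.range i < ⊤ := by
    rw [lt_top_iff_ne_top]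
    intro h
    rw [h, finrank_top, Module.finrank_fin_fun] at hW
    omega
  obtain ⟨l, hl, hle⟩ := Submodule.exists_le_ker_of_lt_top _ hlt
  have hker : LinearMap.range i = LinearMap.ker l := by
    apply Submodule.eq_of_le_of_finrank_eq hle
    have h1 := LinearMap.finrank_range_add_finrank_ker l
    have h2 : Module.finrank ℝ (LinearMap.range l) = 1 := by
      rw [LinearMap.range_eq_top.mpr (LinearMap.surjective hl), finrank_top, Module.finrank_self]
    rw [Module.finrank_fin_fun] at h1
    omega
  have hl' : ∀ v, l v = ∑ k, v k * l (Pi.single k 1) := by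
    intro v
    conv_lhs => rw [← Finset.univ_sum_single v, map_sum]
    refine Finset.sum_congr rfl fun k _ => ?_
    rw [← smul_eq_mul, ← map_smul, ← Pi.single_smul, smul_eq_mul, mul_one]
  set n : Fin 7 → ℝ := fun k => ![-ε, -ε, -ε, -ε, 1, 1, 1] k * l (Pi.single k 1) with hn
  have hnv : ∀ v, modelMetric ε n v = l v := by
    intro v
    rw [hl', modelMetric_apply, Fin.sum_univ_seven]
    rcases hε with rfl | rfl <;> simp [hn] <;> ring
  have hmem : ∀ v, (∃ u, i u = v) ↔ modelMetric ε n v = 0 := by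
    intro v
    rw [hnv, ← LinearMap.mem_ker, ← hker, LinearMap.mem_range]
  have hcr : ∀ u, cross ε n (i u) ∈ LinearMap.range i := by
    intro u
    rw [LinearMap.mem_range, hmem, modelMetric_symm, modelMetric_cross hε]
    exact (modelForm ε).map_eq_zero_of_eq ![n, i u, n] (i := 0) (j := 2) rfl (by decide)
  refine ⟨n, (LinearEquiv.ofInjective i hi).symm.toLinearMap ∘ₗ
    ((cross ε n ∘ₗ i).codRestrict (LinearMap.range i) hcr), ?_, hmem, ?_⟩
  · intro h
    exact hl (LinearMap.ext fun v => by rw [← hnv, h]; simp)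
  · intro u
    have h := (LinearEquiv.ofInjective i hi).apply_symm_apply
      ((cross ε n ∘ₗ i).codRestrict (LinearMap.range i) hcr u)
    exact congrArg Subtype.val h

variable {ε : ℝ} {i : U →ₗ[ℝ] (Fin 7 → ℝ)} {n : Fin 7 → ℝ} {J : Module.End ℝ U}

theorem IsNormal.orthogonal (h : IsNormal ε i n J) (u : U) : modelMetric ε n (i u) = 0 :=
  (h.mem_iff _).mp ⟨u, rfl⟩

theorem IsNormal.J_J (h : IsNormal ε i n J) (hε : ε = 1 ∨ ε = -1) (hi : Function.Injective i)
    (u : U) : J (J u) = -modelMetric ε n n • u := by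
  apply hi
  rw [h.cross_eq, h.cross_eq, cross_cross hε, h.orthogonal, zero_smul, add_zero, map_smul]

theorem IsNormal.rhoSymmetric (h : IsNormal ε i n J) (hε : ε = 1 ∨ ε = -1) :
    IsRhoSymmetric ((modelForm ε).compLinearMap i) J := by
  intro x y z
  have e := cross_rhoSymmetric hε n (i x) (i y) (i z)
  simp only [h.orthogonal, mul_zero, zero_mul, sub_zero, add_zero, ← h.cross_eq] at e
  simp only [tri_apply, AlternatingMap.compLinearMap_apply]
  convert sub_eq_zero.mp e using 2 <;> ext k <;> fin_cases k <;> rfl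

theorem tri_compLinearMap {V : Type*} [AddCommGroup V] [Module ℝ V] (φ : V [⋀^Fin 3]→ₗ[ℝ] ℝ)
    (i : U →ₗ[ℝ] V) (x y z : U) : tri (φ.compLinearMap i) x y z = φ ![i x, i y, i z] := by
  rw [tri_apply, AlternatingMap.compLinearMap_apply]
  congr 1
  ext k
  fin_cases k <;> rfl

theorem modelMetric_nondegenerate (hε : ε = 1 ∨ ε = -1) {x : Fin 7 → ℝ}
    (hx : ∀ y, modelMetric ε x y = 0) : x = 0 := by
  ext k
  have h := hx (Pi.single k 1)
  rw [modelMetric_apply] at h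
  rcases hε with rfl | rfl <;> fin_cases k <;> simpa [Pi.single_apply] using h

theorem IsNormal.exists_decomposition (h : IsNormal ε i n J) (hε : ε = 1 ∨ ε = -1) :
    ∃ m, ∀ v, ∃ t : ℝ, ∃ w ∈ LinearMap.range i, v = t • m + w := by
  obtain ⟨m, hm⟩ : ∃ m, modelMetric ε n m ≠ 0 := by
    by_contra! h0
    exact h.ne_zero (modelMetric_nondegenerate hε h0)
  refine ⟨m, fun v => ⟨modelMetric ε n v / modelMetric ε n m,
    v - (modelMetric ε n v / modelMetric ε n m) • m, ?_, by abel⟩⟩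
  rw [LinearMap.mem_range, h.mem_iff, map_sub, map_smul, smul_eq_mul, div_mul_cancel₀ _ hm,
    sub_self]

theorem IsNormal.eq_zero_of_contraction (h : IsNormal ε i n J) (hε : ε = 1 ∨ ε = -1)
    {x : Fin 7 → ℝ} (hx : ∀ u v, modelForm ε ![x, i u, i v] = 0) : x = 0 := by
  obtain ⟨m, hm⟩ := h.exists_decomposition hε
  refine modelForm_contraction hε hm ?_
  rintro _ ⟨u, rfl⟩ _ ⟨v, rfl⟩
  exact hx u v

theorem IsNormal.nondegenerateForm (h : IsNormal ε i n J) (hε : ε = 1 ∨ ε = -1)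
    (hi : Function.Injective i) : IsNondegenerateForm ((modelForm ε).compLinearMap i) := by
  intro x hx
  apply hi
  rw [map_zero]
  refine h.eq_zero_of_contraction hε fun u v => ?_
  rw [← tri_compLinearMap, hx]

theorem IsNormal.metric_J (h : IsNormal ε i n J) (hε : ε = 1 ∨ ε = -1) (u v : U) :
    modelMetric ε (i (J u)) (i v) = tri (modelForm ε) n (i u) (i v) := by
  rw [h.cross_eq, modelMetric_cross hε, tri_apply]

theorem IsNormal.J_ne_zero (h : IsNormal ε i n J) (hε : ε = 1 ∨ ε = -1) : J ≠ 0 := by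
  rintro rfl
  refine h.ne_zero (h.eq_zero_of_contraction hε fun u v => ?_)
  rw [← tri_apply, ← h.metric_J hε]
  simp

/-- `g(J u, v) = φ(n, u, v)` is skew in `u, v`, while `s g(u, v)` is symmetric. If `J` were `s`
times the identity, both would vanish on the hyperplane, forcing `n = 0`. This guarantees that both
eigenspaces occur in the split case. -/
theorem IsNormal.exists_J_ne_smul (h : IsNormal ε i n J) (hε : ε = 1 ∨ ε = -1) (s : ℝ) :
    ∃ x, J x ≠ s • x := by
  by_contra! hs
  refine h.ne_zero (h.eq_zero_of_contraction hε fun u v => ?_)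
  have h1 := h.metric_J hε u v
  have h2 := h.metric_J hε v u
  rw [hs, map_smul, map_smul, LinearMap.smul_apply, smul_eq_mul] at h1 h2
  rw [tri_swap_right, modelMetric_symm] at h2
  rw [← tri_apply]
  linarith

theorem IsRhoSymmetric.smul {ρ : U [⋀^Fin 3]→ₗ[ℝ] ℝ} (h : IsRhoSymmetric ρ J) (s : ℝ) :
    IsRhoSymmetric ρ (s • J) := by
  intro x y z
  simp only [LinearMap.smul_apply, map_smul, h x y z]

theorem IsNormal.complex_block (h : IsNormal ε i n J) (hε : ε = 1 ∨ ε = -1)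
    (hi : Function.Injective i) (hU : Module.finrank ℝ U = 6) (hc : 0 < modelMetric ε n n)
    {T : Module.End ℝ U} (hT : Annihilates ((modelForm ε).compLinearMap i) T) :
    ∃ A B : Matrix (Fin 3) (Fin 3) ℝ, A.trace = 0 ∧ B.trace = 0 ∧
      HasBlockMatrix T (Matrix.fromBlocks A B (-B) A) := by
  refine exists_complex_block hU (h.nondegenerateForm hε hi)
    ((h.rhoSymmetric hε).smul (√(modelMetric ε n n))⁻¹) (fun x => ?_) hT
  simp only [LinearMap.smul_apply, map_smul, h.J_J hε hi, smul_smul]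
  congr 1
  have h0 : √(modelMetric ε n n) ≠ 0 := (Real.sqrt_pos.mpr hc).ne'
  field_simp
  linarith [Real.sq_sqrt hc.le]

theorem IsNormal.split_block (h : IsNormal ε i n J) (hε : ε = 1 ∨ ε = -1)
    (hi : Function.Injective i) (hU : Module.finrank ℝ U = 6) (hc : modelMetric ε n n < 0)
    {T : Module.End ℝ U} (hT : Annihilates ((modelForm ε).compLinearMap i) T) :
    ∃ A B : Matrix (Fin 3) (Fin 3) ℝ, A.trace = 0 ∧ B.trace = 0 ∧
      HasBlockMatrix T (Matrix.fromBlocks A 0 0 B) := by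
  have hc' : 0 < -modelMetric ε n n := by linarith
  have h0 : √(-modelMetric ε n n) ≠ 0 := (Real.sqrt_pos.mpr hc').ne'
  refine exists_split_block hU (h.nondegenerateForm hε hi)
    ((h.rhoSymmetric hε).smul (√(-modelMetric ε n n))⁻¹) (fun x => ?_) ?_ ?_ hT
  · simp only [LinearMap.smul_apply, map_smul, h.J_J hε hi, smul_smul]
    congr 1
    field_simp
    linarith [Real.sq_sqrt hc'.le]
  · obtain ⟨x, hx⟩ := h.exists_J_ne_smul hε (√(-modelMetric ε n n))
    refine ⟨x, fun e => hx ?_⟩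
    rw [← e, LinearMap.smul_apply, smul_smul, mul_inv_cancel₀ h0, one_smul]
    rw [LinearMap.smul_apply] at e
    rw [e]
  · obtain ⟨x, hx⟩ := h.exists_J_ne_smul hε (-√(-modelMetric ε n n))
    refine ⟨x, fun e => hx ?_⟩
    rw [LinearMap.smul_apply] at e
    rw [neg_smul, ← smul_neg, ← e, smul_smul, mul_inv_cancel₀ h0, one_smul]

theorem IsNormal.null_block (h : IsNormal ε i n J) (hε : ε = 1 ∨ ε = -1)
    (hi : Function.Injective i) (hU : Module.finrank ℝ U = 6) (hc : modelMetric ε n n = 0)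
    {T : Module.End ℝ U} (hT : Annihilates ((modelForm ε).compLinearMap i) T) :
    ∃ A B : Matrix (Fin 3) (Fin 3) ℝ, B.trace = 0 ∧
      HasBlockMatrix T (Matrix.fromBlocks A 0 B (A - A.trace • (1 : Matrix (Fin 3) (Fin 3) ℝ))) :=
  exists_null_block hU (h.nondegenerateForm hε hi) (h.rhoSymmetric hε)
    (fun x => by rw [h.J_J hε hi, hc, neg_zero]) (h.J_ne_zero hε) hT

end Hyperplane

/-! ### How the sign of `g(n,n)` is read off from the signature of the hyperplane. -/

section Signature

variable {U : Type*} [AddCommGroup U] [Module ℝ U]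
variable {i : U →ₗ[ℝ] (Fin 7 → ℝ)} {n : Fin 7 → ℝ} {J : Module.End ℝ U}

/-- A null `n` lies in its own orthogonal hyperplane and spans a radical there. Otherwise the
hyperplane and `n` together span everything. -/
theorem IsNormal.nondegenerate_iff {ε : ℝ} (h : IsNormal ε i n J) (hε : ε = 1 ∨ ε = -1)
    (hi : Function.Injective i) :
    ((modelMetric ε).comp i i).Nondegenerate ↔ modelMetric ε n n ≠ 0 := by
  constructor
  · intro hnd hc
    obtain ⟨u, hu⟩ := (h.mem_iff n).mpr hc
    refine h.ne_zero ?_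
    rw [← hu, hnd.1 u fun v => ?_, map_zero]
    rw [LinearMap.BilinForm.comp_apply, hu, h.orthogonal]
  · intro hc
    have hsep : ∀ u, (∀ v, modelMetric ε (i u) (i v) = 0) → u = 0 := by
      intro u hu
      apply hi
      rw [map_zero]
      refine modelMetric_nondegenerate hε fun y => ?_
      obtain ⟨v, hv⟩ := (h.mem_iff (y - (modelMetric ε n y / modelMetric ε n n) • n)).mpr (by
        rw [map_sub, map_smul, smul_eq_mul, div_mul_cancel₀ _ hc, sub_self])
      have h1 := hu v
      rw [hv, map_sub, map_smul, modelMetric_symm ε (i u) n, h.orthogonal, smul_zero,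
        sub_zero] at h1
      exact h1
    refine ⟨fun u hu => hsep u hu, fun u hu => hsep u fun v => ?_⟩
    rw [modelMetric_symm]
    exact hu v

/-- The rescaled `J` is an involution that reverses the sign of the metric, so it identifies the
quadratic form with its negative. This excludes signature `(2,4)`. -/
theorem IsNormal.sigPos_eq_sigNeg {ε : ℝ} (h : IsNormal ε i n J) (hε : ε = 1 ∨ ε = -1)
    (hi : Function.Injective i) (hc : modelMetric ε n n < 0) :
    sigPos (LinearMap.BilinMap.toQuadraticMap ((modelMetric ε).comp i i)) =
      sigNeg (LinearMap.BilinMap.toQuadraticMap ((modelMetric ε).comp i i)) := by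
  have hc' : 0 < -modelMetric ε n n := by linarith
  have h0 : √(-modelMetric ε n n) ≠ 0 := (Real.sqrt_pos.mpr hc').ne'
  rw [← sigPos_neg]
  set K : Module.End ℝ U := (√(-modelMetric ε n n))⁻¹ • J with hK
  have hKK : Function.Involutive K := by
    intro x
    simp only [hK, LinearMap.smul_apply, map_smul, h.J_J hε hi, smul_smul]
    conv_rhs => rw [← one_smul ℝ x]
    congr 1
    field_simp
    linarith [Real.sq_sqrt hc'.le]
  refine QuadraticMap.Equivalent.sigPos_eq ⟨⟨LinearEquiv.ofInvolutive K hKK, fun x => ?_⟩⟩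
  have h1 : modelMetric ε (i (J x)) (i (J x)) = modelMetric ε n n * modelMetric ε (i x) (i x) := by
    rw [h.metric_J hε, tri_swap_right, ← h.metric_J hε, h.J_J hε hi, map_smul, map_smul,
      LinearMap.smul_apply, smul_eq_mul, neg_mul, neg_neg]
  change -(modelMetric ε (i (K x)) (i (K x))) = modelMetric ε (i x) (i x)
  simp only [hK, LinearMap.smul_apply, map_smul, smul_eq_mul, h1]
  field_simp
  rw [Real.sq_sqrt hc'.le]
  ring

/-- A positive definite subspace of the hyperplane stays positive definite after adding the line of
`n`, and positive definite subspaces of the model inject into the last three coordinates. This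
excludes signature `(3,3)`. -/
theorem IsNormal.sigPos_le_two (h : IsNormal 1 i n J) (hU : Module.finrank ℝ U = 6)
    (hc : 0 < modelMetric 1 n n) :
    sigPos (LinearMap.BilinMap.toQuadraticMap ((modelMetric 1).comp i i)) ≤ 2 := by
  have : Module.Finite ℝ U := Module.finite_of_finrank_pos (by omega)
  obtain ⟨P, hP, hpos⟩ := exists_finrank_eq_sigPos_and_posDef
    (LinearMap.BilinMap.toQuadraticMap ((modelMetric 1).comp i i))
  rw [← hP]
  let k : P × ℝ →ₗ[ℝ] (Fin 7 → ℝ) := (i ∘ₗ P.subtype).coprod (LinearMap.toSpanSingleton ℝ _ n)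
  let l : P × ℝ →ₗ[ℝ] (Fin 3 → ℝ) := (LinearMap.funLeft ℝ ℝ ![4, 5, 6]) ∘ₗ k
  have hl : Function.Injective l := by
    rw [← LinearMap.ker_eq_bot, LinearMap.ker_eq_bot']
    rintro ⟨u, t⟩ hu
    have hk : k (u, t) = i u + t • n := by simp [k]
    have e4 : k (u, t) 4 = 0 := congrFun hu 0
    have e5 : k (u, t) 5 = 0 := congrFun hu 1
    have e6 : k (u, t) 6 = 0 := congrFun hu 2
    have hle : modelMetric 1 (k (u, t)) (k (u, t)) ≤ 0 := by
      rw [modelMetric_apply, e4, e5, e6]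
      nlinarith [mul_self_nonneg (k (u, t) 0), mul_self_nonneg (k (u, t) 1),
        mul_self_nonneg (k (u, t) 2), mul_self_nonneg (k (u, t) 3)]
    have heq : modelMetric 1 (k (u, t)) (k (u, t)) =
        modelMetric 1 (i u) (i u) + t * t * modelMetric 1 n n := by
      rw [hk]
      simp only [map_add, map_smul, LinearMap.add_apply, LinearMap.smul_apply, smul_eq_mul,
        modelMetric_symm 1 (i u) n, h.orthogonal]
      ring
    have ht : 0 ≤ t * t * modelMetric 1 n n := mul_nonneg (mul_self_nonneg t) hc.le
    have hu0 : u = 0 := by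
      by_contra hne
      have : 0 < modelMetric 1 (i u) (i u) := hpos u hne
      linarith
    subst hu0
    rw [Prod.mk_eq_zero]
    refine ⟨rfl, ?_⟩
    simp only [ZeroMemClass.coe_zero, map_zero, zero_add] at heq
    have : t * t * modelMetric 1 n n = 0 := le_antisymm (by linarith) ht
    exact mul_self_eq_zero.mp ((mul_eq_zero.mp this).resolve_right hc.ne')
  have := LinearMap.finrank_le_finrank_of_injective hl
  rw [Module.finrank_prod, Module.finrank_self, Module.finrank_fin_fun] at this
  omega

end Signature

/-! ### Closedness of a three-form on an almost Abelian Lie algebra. -/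

section LieAlgebra

variable {𝔤 : Type*} [LieRing 𝔤] [LieAlgebra ℝ 𝔤]

/-- The inclusion of a Lie ideal as a linear map. -/
def idealIncl (𝔲 : LieIdeal ℝ 𝔤) : 𝔲 →ₗ[ℝ] 𝔤 := 𝔲.toSubmodule.subtype

theorem idealIncl_apply (𝔲 : LieIdeal ℝ 𝔤) (u : 𝔲) : idealIncl 𝔲 u = (u : 𝔤) := rfl

theorem idealIncl_injective (𝔲 : LieIdeal ℝ 𝔤) : Function.Injective (idealIncl 𝔲) :=
  Subtype.val_injective

theorem lie_eq_zero_of_abelian {𝔲 : LieIdeal ℝ 𝔤} (hab : IsLieAbelian 𝔲) (u v : 𝔲) :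
    ⁅(u : 𝔤), (v : 𝔤)⁆ = 0 := by
  have h := hab.trivial u v
  exact congrArg Subtype.val h

theorem extDeriv_eq (φ : 𝔤 [⋀^Fin 3]→ₗ[ℝ] ℝ) (X Y Z W : 𝔤) :
    extDeriv φ X Y Z W = -tri φ ⁅X, Y⁆ Z W + tri φ ⁅X, Z⁆ Y W - tri φ ⁅X, W⁆ Y Z
      - tri φ ⁅Y, Z⁆ X W + tri φ ⁅Y, W⁆ X Z - tri φ ⁅Z, W⁆ X Y := rfl

theorem IsClosedForm.annihilates {φ : 𝔤 [⋀^Fin 3]→ₗ[ℝ] ℝ} (hφ : IsClosedForm φ)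
    {𝔲 : LieIdeal ℝ 𝔤} (hab : IsLieAbelian 𝔲) (x : 𝔤) :
    Annihilates (φ.compLinearMap (idealIncl 𝔲)) (LieModule.toEnd ℝ 𝔤 𝔲 x) := by
  intro u v w
  have h := hφ x u v w
  rw [extDeriv_eq, lie_eq_zero_of_abelian hab, lie_eq_zero_of_abelian hab,
    lie_eq_zero_of_abelian hab] at h
  simp only [map_zero, LinearMap.zero_apply, sub_zero, add_zero] at h
  rw [tri_compLinearMap, tri_compLinearMap, tri_compLinearMap]
  simp only [idealIncl_apply, LieModule.toEnd_apply_apply, LieSubmodule.coe_bracket, ← tri_apply]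
  rw [tri_swap_left φ ⁅x, (v : 𝔤)⁆ u w, tri_swap_right φ u ⁅x, (w : 𝔤)⁆ v,
    tri_swap_left φ ⁅x, (w : 𝔤)⁆ u v]
  linarith

theorem exists_smul_add_mem (h𝔤 : Module.finrank ℝ 𝔤 = 7) {𝔲 : LieIdeal ℝ 𝔤}
    (h𝔲 : Module.finrank ℝ 𝔲 = 6) {x : 𝔤} (hx : x ∉ 𝔲) :
    Function.Bijective ((idealIncl 𝔲).coprod (LinearMap.toSpanSingleton ℝ 𝔤 x)) := by
  have : Module.Finite ℝ 𝔤 := Module.finite_of_finrank_pos (by omega)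
  have : Module.Finite ℝ 𝔲 := Module.finite_of_finrank_pos (by omega)
  have hinj : Function.Injective ((idealIncl 𝔲).coprod (LinearMap.toSpanSingleton ℝ 𝔤 x)) := by
    rw [← LinearMap.ker_eq_bot, LinearMap.ker_eq_bot']
    rintro ⟨u, t⟩ h
    have h : (u : 𝔤) + t • x = 0 := by simpa [idealIncl_apply] using h
    have ht : t = 0 := by
      by_contra ht
      apply hx
      have e : x = (-t⁻¹) • (u : 𝔤) := by
        rw [eq_neg_of_add_eq_zero_left h, neg_smul_neg, smul_smul, inv_mul_cancel₀ ht, one_smul]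
      rw [e]
      exact 𝔲.smul_mem _ u.2
    subst ht
    rw [zero_smul, add_zero] at h
    rw [Prod.mk_eq_zero]
    exact ⟨Subtype.ext h, rfl⟩
  exact ⟨hinj, (LinearMap.injective_iff_surjective_of_finrank_eq_finrank
    (by rw [Module.finrank_prod, h𝔲, Module.finrank_self, h𝔤])).mp hinj⟩

/-- With `𝔤 = 𝔲 ⊕ ℝx`, all brackets are combinations of brackets `[x, u]`. In the expansion of `dφ`
the terms that contain `x` in a further slot cancel, and the others group into instances of the
annihilation identity. -/
theorem isClosedForm_of_annihilates (h𝔤 : Module.finrank ℝ 𝔤 = 7) {𝔲 : LieIdeal ℝ 𝔤}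
    (h𝔲 : Module.finrank ℝ 𝔲 = 6) (hab : IsLieAbelian 𝔲) {x : 𝔤} (hx : x ∉ 𝔲)
    {φ : 𝔤 [⋀^Fin 3]→ₗ[ℝ] ℝ}
    (h : Annihilates (φ.compLinearMap (idealIncl 𝔲)) (LieModule.toEnd ℝ 𝔤 𝔲 x)) :
    IsClosedForm φ := by
  have hdec : ∀ X : 𝔤, ∃ (a : ℝ) (u : 𝔲), X = (u : 𝔤) + a • x := by
    intro X
    obtain ⟨⟨u, a⟩, hu⟩ := (exists_smul_add_mem h𝔤 h𝔲 hx).2 X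
    exact ⟨a, u, by rw [← hu]; simp [idealIncl_apply]⟩
  have hT : ∀ u v w : 𝔲, tri φ ⁅x, (u : 𝔤)⁆ v w - tri φ ⁅x, (v : 𝔤)⁆ u w
      + tri φ ⁅x, (w : 𝔤)⁆ u v = 0 := by
    intro u v w
    have e := h u v w
    rw [tri_compLinearMap, tri_compLinearMap, tri_compLinearMap] at e
    simp only [idealIncl_apply, LieModule.toEnd_apply_apply, LieSubmodule.coe_bracket,
      ← tri_apply] at e
    rw [tri_swap_left φ ⁅x, (v : 𝔤)⁆ u w, tri_swap_right φ u ⁅x, (w : 𝔤)⁆ v,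
      tri_swap_left φ ⁅x, (w : 𝔤)⁆ u v] at e
    linarith
  have hbr : ∀ (a b : ℝ) (u v : 𝔲),
      ⁅(u : 𝔤) + a • x, (v : 𝔤) + b • x⁆ = a • ⁅x, (v : 𝔤)⁆ - b • ⁅x, (u : 𝔤)⁆ := by
    intro a b u v
    rw [add_lie, lie_add, lie_add, lie_eq_zero_of_abelian hab, smul_lie, smul_lie, lie_smul,
      lie_smul, lie_self, ← lie_skew x (u : 𝔤), smul_zero, smul_zero, add_zero, zero_add, smul_neg]
    abel
  intro X Y Z W
  obtain ⟨a, u, rfl⟩ := hdec X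
  obtain ⟨b, v, rfl⟩ := hdec Y
  obtain ⟨c, w, rfl⟩ := hdec Z
  obtain ⟨d, z, rfl⟩ := hdec W
  rw [extDeriv_eq, hbr, hbr, hbr, hbr, hbr, hbr]
  simp only [map_add, map_sub, map_smul, LinearMap.add_apply, LinearMap.sub_apply,
    LinearMap.smul_apply, smul_eq_mul, tri_self_right]
  rw [tri_swap_right φ _ x (u : 𝔤), tri_swap_right φ _ x (u : 𝔤)]
  have sw : ∀ p q : 𝔲, tri φ ⁅x, (p : 𝔤)⁆ x (q : 𝔤) = - tri φ ⁅x, (p : 𝔤)⁆ (q : 𝔤) x :=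
    fun p q => tri_swap_right _ _ _ _
  simp only [sw]
  linear_combination -a * hT v w z + b * hT u w z - c * hT u v z + d * hT u v w

end LieAlgebra

/-! ### Building closed forms from block matrices by explicit model coordinates. -/

section Construction

variable {𝔤 : Type*} [LieRing 𝔤] [LieAlgebra ℝ 𝔤]

/-- A calibrated structure from a linear isomorphism of the coordinate space with the model. -/
theorem exists_adapted_of_block (h𝔤 : Module.finrank ℝ 𝔤 = 7) {𝔲 : LieIdeal ℝ 𝔤}
    (h𝔲 : Module.finrank ℝ 𝔲 = 6) (hab : IsLieAbelian 𝔲) {x : 𝔤} (hx : x ∉ 𝔲)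
    {M : Matrix (Fin 3 ⊕ Fin 3) (Fin 3 ⊕ Fin 3) ℝ}
    (hM : HasBlockMatrix (LieModule.toEnd ℝ 𝔤 𝔲 x) M)
    (L : ((Fin 3 ⊕ Fin 3 → ℝ) × ℝ) ≃ₗ[ℝ] (Fin 7 → ℝ)) (ε : ℝ)
    (hL : ∀ c d e, modelForm ε ![L (M.mulVec c, 0), L (d, 0), L (e, 0)] +
      modelForm ε ![L (c, 0), L (M.mulVec d, 0), L (e, 0)] +
      modelForm ε ![L (c, 0), L (d, 0), L (M.mulVec e, 0)] = 0) :
    ∃ f : 𝔤 ≃ₗ[ℝ] (Fin 7 → ℝ), IsClosedForm ((modelForm ε).compLinearMap f.toLinearMap) ∧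
      ∃ e : 𝔲 ≃ₗ[ℝ] (Fin 3 ⊕ Fin 3 → ℝ), ∀ u : 𝔲, f u = L (e u, 0) := by
  obtain ⟨b, hb⟩ := hM
  let ψ := LinearEquiv.ofBijective _ (exists_smul_add_mem h𝔤 h𝔲 hx)
  let f : 𝔤 ≃ₗ[ℝ] (Fin 7 → ℝ) :=
    (ψ.symm.trans (b.equivFun.prodCongr (LinearEquiv.refl ℝ ℝ))).trans L
  have hf : ∀ u : 𝔲, f u = L (b.equivFun u, 0) := by
    intro u
    have : ψ.symm (u : 𝔤) = (u, 0) := by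
      rw [LinearEquiv.symm_apply_eq]
      simp [ψ, idealIncl_apply]
    simp [f, this]
  have hTb : ∀ u : 𝔲, b.equivFun (LieModule.toEnd ℝ 𝔤 𝔲 x u) = M.mulVec (b.equivFun u) := by
    intro u
    rw [← hb]
    exact (LinearMap.toMatrix_mulVec_repr b b _ u).symm
  refine ⟨f, isClosedForm_of_annihilates h𝔤 h𝔲 hab hx ?_, b.equivFun, hf⟩
  intro u v w
  simp only [tri_compLinearMap, AlternatingMap.compLinearMap_apply]
  have key := hL (b.equivFun u) (b.equivFun v) (b.equivFun w)
  simp only [← hTb, ← hf] at key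
  convert key using 3 <;> congr 1 <;> ext k : 1 <;> fin_cases k <;> rfl

/-- The hyperplane is `e₇ = 0`, with complex coordinates `e₁ + i e₂, e₃ + i e₄, e₅ + i e₆`. -/
def complexCoords : ((Fin 3 ⊕ Fin 3 → ℝ) × ℝ) ≃ₗ[ℝ] (Fin 7 → ℝ) where
  toFun p := ![p.1 (.inl 0), p.1 (.inr 0), p.1 (.inl 1), p.1 (.inr 1), p.1 (.inl 2), p.1 (.inr 2),
    p.2]
  invFun v := (Sum.elim ![v 0, v 2, v 4] ![v 1, v 3, v 5], v 6)
  map_add' p q := by ext k; fin_cases k <;> rfl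
  map_smul' p q := by ext k; fin_cases k <;> rfl
  left_inv p := by
    refine Prod.ext (funext ?_) rfl
    rintro (k | k) <;> fin_cases k <;> rfl
  right_inv v := by ext k; fin_cases k <;> rfl

/-- The hyperplane is `e₁ = 0`, with coordinates spanning its two isotropic subspaces. -/
noncomputable def splitCoords : ((Fin 3 ⊕ Fin 3 → ℝ) × ℝ) ≃ₗ[ℝ] (Fin 7 → ℝ) where
  toFun p := ![p.2, p.1 (.inr 0) - p.1 (.inl 0), (p.1 (.inl 1) + p.1 (.inr 1)) / 2,
    (p.1 (.inl 2) + p.1 (.inr 2)) / 2, (p.1 (.inr 1) - p.1 (.inl 1)) / 2,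
    (p.1 (.inl 2) - p.1 (.inr 2)) / 2, -(p.1 (.inl 0) + p.1 (.inr 0))]
  invFun v := (Sum.elim ![-(v 6 + v 1) / 2, v 2 - v 4, v 3 + v 5]
    ![-(v 6 - v 1) / 2, v 2 + v 4, v 3 - v 5], v 0)
  map_add' p q := by ext k; fin_cases k <;> simp <;> ring
  map_smul' p q := by ext k; fin_cases k <;> simp <;> ring
  left_inv p := by
    refine Prod.ext (funext ?_) rfl
    rintro (k | k) <;> fin_cases k <;> simp <;> ring
  right_inv v := by ext k; fin_cases k <;> simp <;> ring

/-- The hyperplane is orthogonal to the null vector `e₁ + e₅`. -/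
def nullCoords : ((Fin 3 ⊕ Fin 3 → ℝ) × ℝ) ≃ₗ[ℝ] (Fin 7 → ℝ) where
  toFun p := ![p.1 (.inr 0) + p.2, -p.1 (.inr 2), p.1 (.inl 0), -p.1 (.inr 1), p.1 (.inr 0),
    p.1 (.inl 1) - p.1 (.inr 2), p.1 (.inl 2) + p.1 (.inr 1)]
  invFun v := (Sum.elim ![v 2, v 5 - v 1, v 6 + v 3] ![v 4, -v 3, -v 1], v 0 - v 4)
  map_add' p q := by ext k; fin_cases k <;> simp <;> ring
  map_smul' p q := by ext k; fin_cases k <;> simp <;> ring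
  left_inv p := by
    refine Prod.ext (funext ?_) (by simp)
    rintro (k | k) <;> fin_cases k <;> simp
  right_inv v := by ext k; fin_cases k <;> simp

theorem fromBlocks_mulVec_coords (A B C D : Matrix (Fin 3) (Fin 3) ℝ) (c : Fin 3 ⊕ Fin 3 → ℝ)
    (k : Fin 3) :
    (Matrix.fromBlocks A B C D).mulVec c (.inl k) =
      A k 0 * c (.inl 0) + A k 1 * c (.inl 1) + A k 2 * c (.inl 2) +
      (B k 0 * c (.inr 0) + B k 1 * c (.inr 1) + B k 2 * c (.inr 2)) ∧
    (Matrix.fromBlocks A B C D).mulVec c (.inr k) =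
      C k 0 * c (.inl 0) + C k 1 * c (.inl 1) + C k 2 * c (.inl 2) +
      (D k 0 * c (.inr 0) + D k 1 * c (.inr 1) + D k 2 * c (.inr 2)) := by
  constructor <;>
    simp [Matrix.mulVec, dotProduct, Fintype.sum_sum_type, Fin.sum_univ_three]

theorem complexCoords_apply (c : Fin 3 ⊕ Fin 3 → ℝ) :
    complexCoords (c, 0) = ![c (.inl 0), c (.inr 0), c (.inl 1), c (.inr 1), c (.inl 2), c (.inr 2),
      0] := rfl

theorem splitCoords_apply (c : Fin 3 ⊕ Fin 3 → ℝ) :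
    splitCoords (c, 0) = ![0, c (.inr 0) - c (.inl 0), (c (.inl 1) + c (.inr 1)) / 2,
      (c (.inl 2) + c (.inr 2)) / 2, (c (.inr 1) - c (.inl 1)) / 2, (c (.inl 2) - c (.inr 2)) / 2,
      -(c (.inl 0) + c (.inr 0))] := rfl

theorem nullCoords_apply (c : Fin 3 ⊕ Fin 3 → ℝ) :
    nullCoords (c, 0) = ![c (.inr 0) + 0, -c (.inr 2), c (.inl 0), -c (.inr 1), c (.inr 0),
      c (.inl 1) - c (.inr 2), c (.inl 2) + c (.inr 1)] := rfl

end Construction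

/-! ### The block matrices annihilate the restricted model forms. -/

section Invariance

/-- On `e₇ = 0` the form is the real part of `(e¹ + ie²) ∧ (e³ + ie⁴) ∧ (e⁵ + ie⁶)`, for every `ε`.
The matrix acts as the trace-free complex matrix `A - iB`. -/
theorem complexCoords_invariant {A B : Matrix (Fin 3) (Fin 3) ℝ} (hA : A.trace = 0)
    (hB : B.trace = 0) (ε : ℝ) (c d e : Fin 3 ⊕ Fin 3 → ℝ) :
    modelForm ε ![complexCoords ((Matrix.fromBlocks A B (-B) A).mulVec c, 0),
        complexCoords (d, 0), complexCoords (e, 0)] +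
      modelForm ε ![complexCoords (c, 0),
        complexCoords ((Matrix.fromBlocks A B (-B) A).mulVec d, 0), complexCoords (e, 0)] +
      modelForm ε ![complexCoords (c, 0), complexCoords (d, 0),
        complexCoords ((Matrix.fromBlocks A B (-B) A).mulVec e, 0)] = 0 := by
  rw [Matrix.trace_fin_three] at hA hB
  have hA' : A 2 2 = -A 0 0 - A 1 1 := by linarith
  have hB' : B 2 2 = -B 0 0 - B 1 1 := by linarith
  simp only [modelForm_eq, coordForm_eq, complexCoords_apply, Matrix.cons_val,
    fun k c => (fromBlocks_mulVec_coords A B (-B) A c k).1,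
    fun k c => (fromBlocks_mulVec_coords A B (-B) A c k).2, Matrix.neg_apply, hA', hB']
  ring

/-- In coordinates `a` (left) and `b` (right) the restricted form is `a₀ ∧ a₁ ∧ a₂ + b₀ ∧ b₁ ∧ b₂`.
-/
theorem splitCoords_invariant {A B : Matrix (Fin 3) (Fin 3) ℝ} (hA : A.trace = 0)
    (hB : B.trace = 0) (c d e : Fin 3 ⊕ Fin 3 → ℝ) :
    modelForm 1 ![splitCoords ((Matrix.fromBlocks A 0 0 B).mulVec c, 0),
        splitCoords (d, 0), splitCoords (e, 0)] +
      modelForm 1 ![splitCoords (c, 0),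
        splitCoords ((Matrix.fromBlocks A 0 0 B).mulVec d, 0), splitCoords (e, 0)] +
      modelForm 1 ![splitCoords (c, 0), splitCoords (d, 0),
        splitCoords ((Matrix.fromBlocks A 0 0 B).mulVec e, 0)] = 0 := by
  rw [Matrix.trace_fin_three] at hA hB
  have hA' : A 2 2 = -A 0 0 - A 1 1 := by linarith
  have hB' : B 2 2 = -B 0 0 - B 1 1 := by linarith
  simp only [modelForm_eq, coordForm_eq, splitCoords_apply, Matrix.cons_val,
    fun k c => (fromBlocks_mulVec_coords A 0 0 B c k).1,
    fun k c => (fromBlocks_mulVec_coords A 0 0 B c k).2, Matrix.zero_apply, hA', hB']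
  ring

/-- In coordinates `a` (left) and `b` (right) the restricted form is `b₀ ∧ a₁ ∧ a₂ + a₀ ∧ b₁ ∧ a₂ +
a₀ ∧ a₁ ∧ b₂`, the derivative at `t = 0` of the volume form of `a + t b`. The block `A`, acting on
both halves, contributes `tr A`, the shift of the lower block contributes `-tr A`, and `B`
contributes `tr B` times `a₀ ∧ a₁ ∧ a₂`. -/
theorem nullCoords_invariant {A B : Matrix (Fin 3) (Fin 3) ℝ} (hB : B.trace = 0)
    (c d e : Fin 3 ⊕ Fin 3 → ℝ) :
    let M := Matrix.fromBlocks A 0 B (A - A.trace • (1 : Matrix (Fin 3) (Fin 3) ℝ))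
    modelForm 1 ![nullCoords (M.mulVec c, 0), nullCoords (d, 0), nullCoords (e, 0)] +
      modelForm 1 ![nullCoords (c, 0), nullCoords (M.mulVec d, 0), nullCoords (e, 0)] +
      modelForm 1 ![nullCoords (c, 0), nullCoords (d, 0), nullCoords (M.mulVec e, 0)] = 0 := by
  intro M
  rw [Matrix.trace_fin_three] at hB
  have hB' : B 2 2 = -B 0 0 - B 1 1 := by linarith
  simp only [M, modelForm_eq, coordForm_eq, nullCoords_apply, Matrix.cons_val,
    fun D k c => (fromBlocks_mulVec_coords A 0 B D c k).1,
    fun D k c => (fromBlocks_mulVec_coords A 0 B D c k).2, Matrix.zero_apply, Matrix.sub_apply,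
    Matrix.smul_apply, smul_eq_mul, Matrix.one_apply, Fin.reduceEq, if_true, if_false,
    Matrix.trace_fin_three, hB']
  ring

end Invariance

/-! ### Signatures of coordinate hyperplanes of the model. -/

section CoordinateHyperplane

variable {U : Type*} [AddCommGroup U] [Module ℝ U]
variable {i : U →ₗ[ℝ] (Fin 7 → ℝ)} {k : Fin 7}

theorem modelMetric_one_apply (x y : Fin 7 → ℝ) :
    modelMetric 1 x y = ∑ j, (![-1, -1, -1, -1, 1, 1, 1] : Fin 7 → ℝ) j * (x j * y j) := by
  rw [modelMetric_apply, Fin.sum_univ_seven]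
  simp
  ring

theorem exists_equiv_of_coordinate_eq_zero (hU : Module.finrank ℝ U = 6)
    (hi : Function.Injective i) (hk : ∀ u, i u k = 0) :
    ∃ e : U ≃ₗ[ℝ] (Fin 6 → ℝ), ∀ u j, e u j = i u (k.succAbove j) := by
  have : Module.Finite ℝ U := Module.finite_of_finrank_pos (by omega)
  have hinj : Function.Injective (LinearMap.funLeft ℝ ℝ k.succAbove ∘ₗ i) := by
    rw [← LinearMap.ker_eq_bot, LinearMap.ker_eq_bot']
    intro u hu
    apply hi
    rw [map_zero]
    ext l
    rcases Fin.eq_self_or_eq_succAbove k l with rfl | ⟨j, rfl⟩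
    · exact hk u
    · exact congrFun hu j
  exact ⟨LinearEquiv.ofBijective _ ⟨hinj,
    (LinearMap.injective_iff_surjective_of_finrank_eq_finrank
      (by rw [hU, Module.finrank_fin_fun])).mp hinj⟩, fun u j => rfl⟩

theorem hasSignature_data (hU : Module.finrank ℝ U = 6)
    (hi : Function.Injective i) (hk : ∀ u, i u k = 0) :
    ((modelMetric 1).comp i i).Nondegenerate ∧
    sigPos (LinearMap.BilinMap.toQuadraticMap ((modelMetric 1).comp i i)) =
      {j | 0 < (![-1, -1, -1, -1, 1, 1, 1] : Fin 7 → ℝ) (k.succAbove j)}.ncard ∧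
    sigNeg (LinearMap.BilinMap.toQuadraticMap ((modelMetric 1).comp i i)) =
      {j | (![-1, -1, -1, -1, 1, 1, 1] : Fin 7 → ℝ) (k.succAbove j) < 0}.ncard := by
  obtain ⟨e, he⟩ := exists_equiv_of_coordinate_eq_zero hU hi hk
  have hB : ∀ u v, modelMetric 1 (i u) (i v) =
      ∑ j, (![-1, -1, -1, -1, 1, 1, 1] : Fin 7 → ℝ) (k.succAbove j) * (e u j * e v j) := by
    intro u v
    rw [modelMetric_one_apply, Fin.sum_univ_succAbove _ k, hk]
    simp [he]
  have hw : ∀ l, (![-1, -1, -1, -1, 1, 1, 1] : Fin 7 → ℝ) l ≠ 0 := by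
    intro l; fin_cases l <;> simp
  have hsep : ∀ u, (∀ v, modelMetric 1 (i u) (i v) = 0) → u = 0 := by
    intro u hu
    rw [← e.map_eq_zero_iff]
    ext j
    have h := hu (e.symm (Pi.single j 1))
    rw [hB] at h
    simpa [Pi.single_apply, hw] using h
  have hQ : QuadraticMap.Equivalent
      (LinearMap.BilinMap.toQuadraticMap ((modelMetric 1).comp i i))
      (QuadraticMap.weightedSumSquares ℝ
        (fun j => (![-1, -1, -1, -1, 1, 1, 1] : Fin 7 → ℝ) (k.succAbove j))) := by
    refine ⟨⟨e, fun u => ?_⟩⟩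
    rw [QuadraticMap.weightedSumSquares_apply]
    exact (hB u u).symm
  refine ⟨⟨fun u hu => hsep u hu, fun u hu => hsep u fun v => ?_⟩,
    QuadraticForm.sigPos_of_equiv_weightedSumSquares hQ,
    QuadraticForm.sigNeg_of_equiv_weightedSumSquares hQ⟩
  rw [modelMetric_symm]
  exact hu v

theorem ncard_weights_last :
    {j : Fin 6 | 0 < (![-1, -1, -1, -1, 1, 1, 1] : Fin 7 → ℝ) ((6 : Fin 7).succAbove j)}.ncard = 2 ∧
    {j : Fin 6 | (![-1, -1, -1, -1, 1, 1, 1] : Fin 7 → ℝ) ((6 : Fin 7).succAbove j) < 0}.ncard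
      = 4 := by
  constructor
  · rw [show {j : Fin 6 | 0 < (![-1, -1, -1, -1, 1, 1, 1] : Fin 7 → ℝ) ((6 : Fin 7).succAbove j)}
      = (({4, 5} : Finset (Fin 6)) : Set (Fin 6)) by
        ext j; fin_cases j <;> simp [Fin.succAbove, Fin.lt_def],
      Set.ncard_coe_finset]
    rfl
  · rw [show {j : Fin 6 | (![-1, -1, -1, -1, 1, 1, 1] : Fin 7 → ℝ) ((6 : Fin 7).succAbove j) < 0}
      = (({0, 1, 2, 3} : Finset (Fin 6)) : Set (Fin 6)) by
        ext j; fin_cases j <;> simp [Fin.succAbove, Fin.lt_def],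
      Set.ncard_coe_finset]
    rfl

theorem ncard_weights_zero :
    {j : Fin 6 | 0 < (![-1, -1, -1, -1, 1, 1, 1] : Fin 7 → ℝ) ((0 : Fin 7).succAbove j)}.ncard = 3 ∧
    {j : Fin 6 | (![-1, -1, -1, -1, 1, 1, 1] : Fin 7 → ℝ) ((0 : Fin 7).succAbove j) < 0}.ncard
      = 3 := by
  constructor
  · rw [show {j : Fin 6 | 0 < (![-1, -1, -1, -1, 1, 1, 1] : Fin 7 → ℝ) ((0 : Fin 7).succAbove j)}
      = (({3, 4, 5} : Finset (Fin 6)) : Set (Fin 6)) by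
        ext j; fin_cases j <;> simp [Fin.succAbove],
      Set.ncard_coe_finset]
    rfl
  · rw [show {j : Fin 6 | (![-1, -1, -1, -1, 1, 1, 1] : Fin 7 → ℝ) ((0 : Fin 7).succAbove j) < 0}
      = (({0, 1, 2} : Finset (Fin 6)) : Set (Fin 6)) by
        ext j; fin_cases j <;> simp [Fin.succAbove],
      Set.ncard_coe_finset]
    rfl

end CoordinateHyperplane

/-! ### Calibrated structures of each type correspond to block matrices of each shape. -/

section Equivalences

variable {𝔤 : Type*} [LieRing 𝔤] [LieAlgebra ℝ 𝔤]

theorem exists_notMem_of_finrank (h𝔤 : Module.finrank ℝ 𝔤 = 7) {𝔲 : LieIdeal ℝ 𝔤}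
    (h𝔲 : Module.finrank ℝ 𝔲 = 6) : ∃ x : 𝔤, x ∉ 𝔲 := by
  by_contra! h
  have e : 𝔲.toSubmodule = ⊤ := by
    ext x; simpa using h x
  have h6 : Module.finrank ℝ 𝔲.toSubmodule = 6 := h𝔲
  rw [e, finrank_top] at h6
  omega

/-- The coordinates of `𝔲` in an adapted basis. -/
def adaptedIncl (𝔲 : LieIdeal ℝ 𝔤) (f : 𝔤 ≃ₗ[ℝ] (Fin 7 → ℝ)) : 𝔲 →ₗ[ℝ] (Fin 7 → ℝ) :=
  f.toLinearMap ∘ₗ idealIncl 𝔲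

theorem adaptedIncl_injective (𝔲 : LieIdeal ℝ 𝔤) (f : 𝔤 ≃ₗ[ℝ] (Fin 7 → ℝ)) :
    Function.Injective (adaptedIncl 𝔲 f) :=
  f.injective.comp (idealIncl_injective 𝔲)

theorem annihilates_of_isAdapted {𝔲 : LieIdeal ℝ 𝔤} (hab : IsLieAbelian 𝔲) {ε : ℝ}
    {φ : 𝔤 [⋀^Fin 3]→ₗ[ℝ] ℝ} (hφ : IsClosedForm φ) {f : 𝔤 ≃ₗ[ℝ] (Fin 7 → ℝ)}
    (hf : IsAdapted ε φ f) (x : 𝔤) :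
    Annihilates ((modelForm ε).compLinearMap (adaptedIncl 𝔲 f)) (LieModule.toEnd ℝ 𝔤 𝔲 x) := by
  have h := hφ.annihilates hab x
  rw [← hf] at h
  exact h

theorem complex_block_of_calibratedG2 {𝔲 : LieIdeal ℝ 𝔤}
    (h𝔲 : Module.finrank ℝ 𝔲 = 6) (hab : IsLieAbelian 𝔲) {φ : 𝔤 [⋀^Fin 3]→ₗ[ℝ] ℝ}
    (hφ : IsCalibratedG2 φ) (x : 𝔤) :
    ∃ A B : Matrix (Fin 3) (Fin 3) ℝ, A.trace = 0 ∧ B.trace = 0 ∧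
      HasBlockMatrix (LieModule.toEnd ℝ 𝔤 𝔲 x) (Matrix.fromBlocks A B (-B) A) := by
  obtain ⟨⟨f, hf⟩, hcl⟩ := hφ
  have hi := adaptedIncl_injective 𝔲 f
  obtain ⟨n, J, h⟩ := exists_isNormal (ε := -1) (Or.inr rfl) h𝔲 hi
  refine h.complex_block (Or.inr rfl) hi h𝔲 ?_ (annihilates_of_isAdapted hab hcl hf x)
  obtain ⟨k, hk⟩ := Function.ne_iff.mp h.ne_zero
  rw [modelMetric_apply]
  have hpos : 0 < n k * n k := mul_self_pos.mpr hk
  have hnn := fun j => mul_self_nonneg (n j)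
  have h0 := hnn 0
  have h1 := hnn 1
  have h2 := hnn 2
  have h3 := hnn 3
  have h4 := hnn 4
  have h5 := hnn 5
  have h6 := hnn 6
  fin_cases k <;> simp only [Fin.zero_eta, Fin.mk_one, Fin.reduceFinMk] at hpos <;> linarith

theorem exists_isNormal_of_isG2StarMetric {𝔲 : LieIdeal ℝ 𝔤}
    (h𝔲 : Module.finrank ℝ 𝔲 = 6) (hab : IsLieAbelian 𝔲) {φ : 𝔤 [⋀^Fin 3]→ₗ[ℝ] ℝ}
    (hφ : IsCalibratedG2Star φ) {g : LinearMap.BilinForm ℝ 𝔤} (hg : IsG2StarMetric φ g) (x : 𝔤) :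
    ∃ (i : 𝔲 →ₗ[ℝ] (Fin 7 → ℝ)) (n : Fin 7 → ℝ) (J : Module.End ℝ 𝔲),
      Function.Injective i ∧ IsNormal 1 i n J ∧
      Annihilates ((modelForm 1).compLinearMap i) (LieModule.toEnd ℝ 𝔤 𝔲 x) ∧
      g.restrict 𝔲.toSubmodule = (modelMetric 1).comp i i := by
  obtain ⟨f, hf, rfl⟩ := hg
  have hi := adaptedIncl_injective 𝔲 f
  obtain ⟨n, J, h⟩ := exists_isNormal (ε := 1) (Or.inl rfl) h𝔲 hi
  exact ⟨adaptedIncl 𝔲 f, n, J, hi, h, annihilates_of_isAdapted hab hφ.2 hf x, rfl⟩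

theorem complex_block_of_signature {𝔲 : LieIdeal ℝ 𝔤}
    (h𝔲 : Module.finrank ℝ 𝔲 = 6) (hab : IsLieAbelian 𝔲) {φ : 𝔤 [⋀^Fin 3]→ₗ[ℝ] ℝ}
    (hφ : IsCalibratedG2Star φ) {g : LinearMap.BilinForm ℝ 𝔤} (hg : IsG2StarMetric φ g)
    (hs : HasSignature g 𝔲.toSubmodule 2 4) (x : 𝔤) :
    ∃ A B : Matrix (Fin 3) (Fin 3) ℝ, A.trace = 0 ∧ B.trace = 0 ∧
      HasBlockMatrix (LieModule.toEnd ℝ 𝔤 𝔲 x) (Matrix.fromBlocks A B (-B) A) := by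
  obtain ⟨i, n, J, hi, h, hT, hr⟩ := exists_isNormal_of_isG2StarMetric h𝔲 hab hφ hg x
  obtain ⟨hnd, hp, hn⟩ := hs
  have hnd' : ((modelMetric 1).comp i i).Nondegenerate := hr ▸ hnd
  rcases lt_trichotomy (modelMetric 1 n n) 0 with hc | hc | hc
  · have e := h.sigPos_eq_sigNeg (Or.inl rfl) hi hc
    rw [← hr] at e
    have e' := hp.symm.trans (e.trans hn)
    omega
  · exact absurd hc ((h.nondegenerate_iff (Or.inl rfl) hi).mp hnd')
  · exact h.complex_block (Or.inl rfl) hi h𝔲 hc hT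

theorem split_block_of_signature {𝔲 : LieIdeal ℝ 𝔤}
    (h𝔲 : Module.finrank ℝ 𝔲 = 6) (hab : IsLieAbelian 𝔲) {φ : 𝔤 [⋀^Fin 3]→ₗ[ℝ] ℝ}
    (hφ : IsCalibratedG2Star φ) {g : LinearMap.BilinForm ℝ 𝔤} (hg : IsG2StarMetric φ g)
    (hs : HasSignature g 𝔲.toSubmodule 3 3) (x : 𝔤) :
    ∃ A B : Matrix (Fin 3) (Fin 3) ℝ, A.trace = 0 ∧ B.trace = 0 ∧
      HasBlockMatrix (LieModule.toEnd ℝ 𝔤 𝔲 x) (Matrix.fromBlocks A 0 0 B) := by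
  obtain ⟨i, n, J, hi, h, hT, hr⟩ := exists_isNormal_of_isG2StarMetric h𝔲 hab hφ hg x
  obtain ⟨hnd, hp, hn⟩ := hs
  have hnd' : ((modelMetric 1).comp i i).Nondegenerate := hr ▸ hnd
  rcases lt_trichotomy (modelMetric 1 n n) 0 with hc | hc | hc
  · exact h.split_block (Or.inl rfl) hi h𝔲 hc hT
  · exact absurd hc ((h.nondegenerate_iff (Or.inl rfl) hi).mp hnd')
  · have e := h.sigPos_le_two h𝔲 hc
    rw [← hr] at e
    have e' := hp.symm.trans_le e
    omega

theorem null_block_of_degenerate {𝔲 : LieIdeal ℝ 𝔤}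
    (h𝔲 : Module.finrank ℝ 𝔲 = 6) (hab : IsLieAbelian 𝔲) {φ : 𝔤 [⋀^Fin 3]→ₗ[ℝ] ℝ}
    (hφ : IsCalibratedG2Star φ) {g : LinearMap.BilinForm ℝ 𝔤} (hg : IsG2StarMetric φ g)
    (hs : IsDegenerate g 𝔲.toSubmodule) (x : 𝔤) :
    ∃ A B : Matrix (Fin 3) (Fin 3) ℝ, B.trace = 0 ∧
      HasBlockMatrix (LieModule.toEnd ℝ 𝔤 𝔲 x)
        (Matrix.fromBlocks A 0 B (A - A.trace • (1 : Matrix (Fin 3) (Fin 3) ℝ))) := by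
  obtain ⟨i, n, J, hi, h, hT, hr⟩ := exists_isNormal_of_isG2StarMetric h𝔲 hab hφ hg x
  refine h.null_block (Or.inl rfl) hi h𝔲 ?_ hT
  by_contra hc
  exact hs (hr ▸ (h.nondegenerate_iff (Or.inl rfl) hi).mpr hc)

theorem exists_calibratedG2_of_block (h𝔤 : Module.finrank ℝ 𝔤 = 7) {𝔲 : LieIdeal ℝ 𝔤}
    (h𝔲 : Module.finrank ℝ 𝔲 = 6) (hab : IsLieAbelian 𝔲) {x : 𝔤} (hx : x ∉ 𝔲)
    {A B : Matrix (Fin 3) (Fin 3) ℝ} (hA : A.trace = 0) (hB : B.trace = 0)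
    (hM : HasBlockMatrix (LieModule.toEnd ℝ 𝔤 𝔲 x) (Matrix.fromBlocks A B (-B) A)) :
    ∃ φ : 𝔤 [⋀^Fin 3]→ₗ[ℝ] ℝ, IsCalibratedG2 φ := by
  obtain ⟨f, hcl, -⟩ := exists_adapted_of_block h𝔤 h𝔲 hab hx hM complexCoords (-1)
    (complexCoords_invariant hA hB (-1))
  exact ⟨_, ⟨f, rfl⟩, hcl⟩

theorem exists_signature_two_four_of_block (h𝔤 : Module.finrank ℝ 𝔤 = 7) {𝔲 : LieIdeal ℝ 𝔤}
    (h𝔲 : Module.finrank ℝ 𝔲 = 6) (hab : IsLieAbelian 𝔲) {x : 𝔤} (hx : x ∉ 𝔲)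
    {A B : Matrix (Fin 3) (Fin 3) ℝ} (hA : A.trace = 0) (hB : B.trace = 0)
    (hM : HasBlockMatrix (LieModule.toEnd ℝ 𝔤 𝔲 x) (Matrix.fromBlocks A B (-B) A)) :
    ∃ φ : 𝔤 [⋀^Fin 3]→ₗ[ℝ] ℝ, IsCalibratedG2Star φ ∧
      ∃ g : LinearMap.BilinForm ℝ 𝔤, IsG2StarMetric φ g ∧ HasSignature g 𝔲.toSubmodule 2 4 := by
  obtain ⟨f, hcl, e, he⟩ := exists_adapted_of_block h𝔤 h𝔲 hab hx hM complexCoords 1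
    (complexCoords_invariant hA hB 1)
  obtain ⟨h1, h2, h3⟩ := hasSignature_data (k := 6) h𝔲 (adaptedIncl_injective 𝔲 f) (fun u => by
    change f (u : 𝔤) 6 = 0
    rw [he]; rfl)
  rw [ncard_weights_last.1] at h2
  rw [ncard_weights_last.2] at h3
  exact ⟨_, ⟨⟨f, rfl⟩, hcl⟩, _, ⟨f, rfl, rfl⟩, h1, h2, h3⟩

theorem exists_signature_three_three_of_block (h𝔤 : Module.finrank ℝ 𝔤 = 7) {𝔲 : LieIdeal ℝ 𝔤}
    (h𝔲 : Module.finrank ℝ 𝔲 = 6) (hab : IsLieAbelian 𝔲) {x : 𝔤} (hx : x ∉ 𝔲)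
    {A B : Matrix (Fin 3) (Fin 3) ℝ} (hA : A.trace = 0) (hB : B.trace = 0)
    (hM : HasBlockMatrix (LieModule.toEnd ℝ 𝔤 𝔲 x) (Matrix.fromBlocks A 0 0 B)) :
    ∃ φ : 𝔤 [⋀^Fin 3]→ₗ[ℝ] ℝ, IsCalibratedG2Star φ ∧
      ∃ g : LinearMap.BilinForm ℝ 𝔤, IsG2StarMetric φ g ∧ HasSignature g 𝔲.toSubmodule 3 3 := by
  obtain ⟨f, hcl, e, he⟩ := exists_adapted_of_block h𝔤 h𝔲 hab hx hM splitCoords 1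
    (splitCoords_invariant hA hB)
  obtain ⟨h1, h2, h3⟩ := hasSignature_data (k := 0) h𝔲 (adaptedIncl_injective 𝔲 f) (fun u => by
    change f (u : 𝔤) 0 = 0
    rw [he]; rfl)
  rw [ncard_weights_zero.1] at h2
  rw [ncard_weights_zero.2] at h3
  exact ⟨_, ⟨⟨f, rfl⟩, hcl⟩, _, ⟨f, rfl, rfl⟩, h1, h2, h3⟩

theorem exists_degenerate_of_block (h𝔤 : Module.finrank ℝ 𝔤 = 7) {𝔲 : LieIdeal ℝ 𝔤}
    (h𝔲 : Module.finrank ℝ 𝔲 = 6) (hab : IsLieAbelian 𝔲) {x : 𝔤} (hx : x ∉ 𝔲)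
    {A B : Matrix (Fin 3) (Fin 3) ℝ} (hB : B.trace = 0)
    (hM : HasBlockMatrix (LieModule.toEnd ℝ 𝔤 𝔲 x)
      (Matrix.fromBlocks A 0 B (A - A.trace • (1 : Matrix (Fin 3) (Fin 3) ℝ)))) :
    ∃ φ : 𝔤 [⋀^Fin 3]→ₗ[ℝ] ℝ, IsCalibratedG2Star φ ∧
      ∃ g : LinearMap.BilinForm ℝ 𝔤, IsG2StarMetric φ g ∧ IsDegenerate g 𝔲.toSubmodule := by
  obtain ⟨f, hcl, e, he⟩ := exists_adapted_of_block h𝔤 h𝔲 hab hx hM nullCoords 1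
    (nullCoords_invariant hB)
  refine ⟨_, ⟨⟨f, rfl⟩, hcl⟩, _, ⟨f, rfl, rfl⟩, fun hnd => ?_⟩
  -- This vector of `𝔲` is sent to the null vector `e₁ + e₅`, which is orthogonal to all of `𝔲`.
  have h0 : e.symm (Pi.single (.inr 0) 1) = 0 := by
    refine hnd.1 _ fun v => ?_
    change modelMetric 1 (f ((e.symm (Pi.single (.inr 0) 1) : 𝔲) : 𝔤)) (f ((v : 𝔲) : 𝔤)) = 0
    rw [he, he, LinearEquiv.apply_symm_apply, nullCoords_apply, nullCoords_apply,
      modelMetric_apply]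
    simp
  have h1 := congrFun ((LinearEquiv.symm_apply_eq _).mp h0) (.inr 0)
  simp at h1

end Equivalences

/-! ### Similarity of matrices, change of basis, and descent from `ℂ` to `ℝ`. -/

section Similarity

variable {ι κ K : Type*} [Fintype ι] [DecidableEq ι] [Fintype κ] [DecidableEq κ] [Field K]

/-- `M` and `N` are similar matrices. -/
def IsSimilar (M N : Matrix ι ι K) : Prop := ∃ P : Matrix ι ι K, IsUnit P.det ∧ M * P = P * N

theorem IsSimilar.symm {M N : Matrix ι ι K} (h : IsSimilar M N) : IsSimilar N M := by
  obtain ⟨P, hP, h⟩ := h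
  refine ⟨P⁻¹, Matrix.isUnit_nonsing_inv_det P hP, ?_⟩
  calc N * P⁻¹ = P⁻¹ * (P * N) * P⁻¹ := by
        rw [← mul_assoc, Matrix.nonsing_inv_mul P hP, one_mul]
    _ = P⁻¹ * M := by
        rw [← h, mul_assoc, mul_assoc, Matrix.mul_nonsing_inv P hP, mul_one]

theorem IsSimilar.trans {M N L : Matrix ι ι K} (h : IsSimilar M N) (h' : IsSimilar N L) :
    IsSimilar M L := by
  obtain ⟨P, hP, h⟩ := h
  obtain ⟨Q, hQ, h'⟩ := h'
  refine ⟨P * Q, ?_, ?_⟩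
  · rw [Matrix.det_mul]; exact hP.mul hQ
  · rw [← mul_assoc, h, mul_assoc, h', mul_assoc]

theorem IsSimilar.trace_eq {M N : Matrix ι ι K} (h : IsSimilar M N) : M.trace = N.trace := by
  obtain ⟨P, hP, h⟩ := h
  have e : M = P * N * P⁻¹ := by rw [← h, mul_assoc, Matrix.mul_nonsing_inv P hP, mul_one]
  rw [e, Matrix.trace_mul_comm, ← mul_assoc, Matrix.nonsing_inv_mul P hP, one_mul]

theorem IsSimilar.map {L : Type*} [Field L] (f : K →+* L) {M N : Matrix ι ι K}
    (h : IsSimilar M N) : IsSimilar (M.map f) (N.map f) := by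
  obtain ⟨P, hP, h⟩ := h
  refine ⟨P.map f, ?_, ?_⟩
  · rw [← RingHom.mapMatrix_apply, ← RingHom.map_det]
    exact hP.map f
  · rw [← Matrix.map_mul, h, Matrix.map_mul]

theorem IsSimilar.reindex {M N : Matrix ι ι K} (h : IsSimilar M N) (e : ι ≃ κ) :
    IsSimilar (Matrix.reindex e e M) (Matrix.reindex e e N) := by
  obtain ⟨P, hP, h⟩ := h
  refine ⟨Matrix.reindex e e P, by rwa [Matrix.det_reindex_self], ?_⟩
  simp only [Matrix.reindex_apply, Matrix.submatrix_mul_equiv, h]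

theorem isSimilar_reindex_iff {M N : Matrix ι ι K} (e : ι ≃ κ) :
    IsSimilar (Matrix.reindex e e M) (Matrix.reindex e e N) ↔ IsSimilar M N := by
  refine ⟨fun h => ?_, fun h => h.reindex e⟩
  simpa using h.reindex e.symm

theorem IsSimilar.fromBlocks {A A' : Matrix ι ι K} {B B' : Matrix κ κ K} (hA : IsSimilar A A')
    (hB : IsSimilar B B') :
    IsSimilar (Matrix.fromBlocks A 0 0 B) (Matrix.fromBlocks A' 0 0 B') := by
  obtain ⟨P, hP, h⟩ := hA
  obtain ⟨Q, hQ, h'⟩ := hB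
  refine ⟨Matrix.fromBlocks P 0 0 Q, ?_, ?_⟩
  · rw [Matrix.det_fromBlocks_zero₂₁]; exact hP.mul hQ
  · simp [Matrix.fromBlocks_multiply, h, h']

theorem exists_basis_toMatrix_iff {V : Type*} [AddCommGroup V] [Module K V]
    (c : Module.Basis ι K V) (S : Module.End K V) (N : Matrix ι ι K) :
    (∃ b : Module.Basis ι K V, LinearMap.toMatrix b b S = N) ↔
      IsSimilar (LinearMap.toMatrix c c S) N := by
  have key : ∀ b : Module.Basis ι K V,
      LinearMap.toMatrix c c S * c.toMatrix b = c.toMatrix b * LinearMap.toMatrix b b S := by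
    intro b
    rw [linearMap_toMatrix_mul_basis_toMatrix, basis_toMatrix_mul_linearMap_toMatrix]
  constructor
  · rintro ⟨b, rfl⟩
    refine ⟨c.toMatrix b, ?_, key b⟩
    rw [← Matrix.isUnit_iff_isUnit_det]
    exact IsUnit.of_mul_eq_one _ (c.toMatrix_mul_toMatrix_flip b)
  · rintro ⟨P, hP, h⟩
    set b := c.map (Matrix.toLinearEquiv c P hP)
    have hb : c.toMatrix b = P := by
      ext i j
      rw [Module.Basis.toMatrix_apply, Module.Basis.map_apply]
      change c.repr (Matrix.toLin c c P (c j)) i = P i j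
      rw [Matrix.toLin_self]
      simp [Finsupp.single_apply]
    refine ⟨b, ?_⟩
    have hk := key b
    rw [hb, h] at hk
    have hP' : IsUnit P := (Matrix.isUnit_iff_isUnit_det P).mpr hP
    exact (hP'.mul_left_cancel hk).symm

/-- Real matrices which are similar over `ℂ` are similar over `ℝ`. -/
theorem isSimilar_of_map_ofReal {M N : Matrix ι ι ℝ}
    (h : IsSimilar (M.map Complex.ofRealHom) (N.map Complex.ofRealHom)) : IsSimilar M N := by
  obtain ⟨P, hP, h⟩ := h
  set X : Matrix ι ι ℝ := P.map Complex.re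
  set Y : Matrix ι ι ℝ := P.map Complex.im
  have hX : M * X = X * N := by
    ext i j
    have e := congrArg Complex.re (congrFun (congrFun h i) j)
    simpa [Matrix.mul_apply, X] using e
  have hY : M * Y = Y * N := by
    ext i j
    have e := congrArg Complex.im (congrFun (congrFun h i) j)
    simpa [Matrix.mul_apply, Y] using e
  -- The real and imaginary parts `X`, `Y` of `P` both intertwine `M` and `N`. The polynomial `det(X
  -- + tY)` takes the value `det P ≠ 0` at `t = i`, so it is non-zero at some real `t`.
  set p : Polynomial ℝ := (X.map Polynomial.C + (Polynomial.X : Polynomial ℝ) •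
    Y.map Polynomial.C).det with hp
  have hev : ∀ t : ℝ, p.eval t = (X + t • Y).det := by
    intro t
    rw [hp, ← Polynomial.coe_evalRingHom, RingHom.map_det]
    congr 1
    ext i j
    simp
    ring
  have hev' : p.eval₂ Complex.ofRealHom Complex.I = P.det := by
    rw [hp, ← Polynomial.coe_eval₂RingHom, RingHom.map_det]
    congr 1
    ext i j
    simp only [RingHom.mapMatrix_apply, Matrix.map_apply, Matrix.add_apply, Matrix.smul_apply,
      smul_eq_mul, Polynomial.coe_eval₂RingHom, Polynomial.eval₂_add, Polynomial.eval₂_mul,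
      Polynomial.eval₂_C, Polynomial.eval₂_X, X, Y, Complex.ofRealHom_eq_coe]
    rw [mul_comm, Complex.re_add_im]
  obtain ⟨t, ht⟩ : ∃ t : ℝ, p.eval t ≠ 0 := by
    by_contra! h0
    have hp0 : p = 0 := Polynomial.funext fun t => by rw [h0, Polynomial.eval_zero]
    rw [hp0, Polynomial.eval₂_zero] at hev'
    rw [← hev'] at hP
    exact not_isUnit_zero hP
  refine ⟨X + t • Y, ?_, ?_⟩
  · rw [← hev]; exact ht.isUnit
  · rw [mul_add, add_mul, Matrix.mul_smul, Matrix.smul_mul, hX, hY]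

end Similarity

/-! ### Existence of the Jordan form of a complex `3 × 3` matrix by explicit conjugations. -/

section JordanThree

theorem isJordanMatrix_three {a b c s t : ℂ} (hs : s = 0 ∨ (s = 1 ∧ a = b))
    (ht : t = 0 ∨ (t = 1 ∧ b = c)) : IsJordanMatrix !![a, s, 0; 0, b, t; 0, 0, c] := by
  constructor
  · intro i j h1 h2
    fin_cases i <;> fin_cases j <;> simp at h1 h2 ⊢
  · intro i j h
    fin_cases i <;> fin_cases j <;> simp at h ⊢ <;> assumption

/-- `M` is similar to a Jordan matrix. -/
def HasJordanForm (M : Matrix (Fin 3) (Fin 3) ℂ) : Prop := ∃ J, IsJordanMatrix J ∧ IsSimilar M J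

theorem HasJordanForm.of_conj {M N P : Matrix (Fin 3) (Fin 3) ℂ} (hN : HasJordanForm N)
    (hP : P.det ≠ 0) (h : M * P = P * N) : HasJordanForm M := by
  obtain ⟨J, hJ, hs⟩ := hN
  exact ⟨J, hJ, IsSimilar.trans ⟨P, hP.isUnit, h⟩ hs⟩

theorem hasJordanForm_of_isJordan {M : Matrix (Fin 3) (Fin 3) ℂ} (h : IsJordanMatrix M) :
    HasJordanForm M := ⟨M, h, 1, by simp, by simp⟩

theorem hasJordanForm_one_two (a b r c : ℂ) : HasJordanForm !![a, 0, 0; 0, b, r; 0, 0, c] := by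
  by_cases hr : r = 0
  · exact hasJordanForm_of_isJordan (isJordanMatrix_three (.inl rfl) (.inl hr))
  by_cases hc : b = c
  · subst hc
    refine HasJordanForm.of_conj (N := !![a, 0, 0; 0, b, 1; 0, 0, b])
      (P := !![1, 0, 0; 0, r, 0; 0, 0, 1]) ?_ ?_ ?_
    · exact hasJordanForm_of_isJordan (isJordanMatrix_three (.inl rfl) (.inr ⟨rfl, rfl⟩))
    · simpa [Matrix.det_fin_three] using hr
    · ext i j
      fin_cases i <;> fin_cases j <;> simp [Matrix.mul_apply, Fin.sum_univ_three, mul_comm]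
  · have hcb : c - b ≠ 0 := sub_ne_zero.mpr (Ne.symm hc)
    refine HasJordanForm.of_conj (N := !![a, 0, 0; 0, b, 0; 0, 0, c])
      (P := !![1, 0, 0; 0, 1, r / (c - b); 0, 0, 1]) ?_ ?_ ?_
    · exact hasJordanForm_of_isJordan (isJordanMatrix_three (.inl rfl) (.inl rfl))
    · simp [Matrix.det_fin_three]
    · ext i j
      fin_cases i <;> fin_cases j <;> simp [Matrix.mul_apply, Fin.sum_univ_three]
      field_simp
      ring

theorem hasJordanForm_of_top_diagonal (a b q r c : ℂ) :
    HasJordanForm !![a, 0, q; 0, b, r; 0, 0, c] := by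
  by_cases hc : c = a
  · subst hc
    have hswap : ∀ q, HasJordanForm !![c, 0, q; 0, b, 0; 0, 0, c] := by
      intro q
      refine HasJordanForm.of_conj (N := !![b, 0, 0; 0, c, q; 0, 0, c])
        (P := !![0, 1, 0; 1, 0, 0; 0, 0, 1]) (hasJordanForm_one_two _ _ _ _) ?_ ?_
      · simp [Matrix.det_fin_three]
      · ext i j
        fin_cases i <;> fin_cases j <;> simp [Matrix.mul_apply, Fin.sum_univ_three]
    by_cases hr : r = 0
    · subst hr; exact hswap q
    by_cases hb : c = b
    · subst hb
      -- The second column of `P` is the image `(q, r, 0)` of the third basis vector under the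
      -- nilpotent part.
      refine HasJordanForm.of_conj (N := !![c, 0, 0; 0, c, 1; 0, 0, c])
        (P := !![1, q, 0; 0, r, 0; 0, 0, 1]) (hasJordanForm_one_two _ _ _ _) ?_ ?_
      · simpa [Matrix.det_fin_three] using hr
      · ext i j
        fin_cases i <;> fin_cases j <;> simp [Matrix.mul_apply, Fin.sum_univ_three, mul_comm]
    · have hcb : c - b ≠ 0 := sub_ne_zero.mpr hb
      refine HasJordanForm.of_conj (P := !![1, 0, 0; 0, 1, r / (c - b); 0, 0, 1]) (hswap q) ?_ ?_
      · simp [Matrix.det_fin_three]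
      · ext i j
        fin_cases i <;> fin_cases j <;> simp [Matrix.mul_apply, Fin.sum_univ_three]
        field_simp
        ring
  · have hca : c - a ≠ 0 := sub_ne_zero.mpr hc
    refine HasJordanForm.of_conj (N := !![a, 0, 0; 0, b, r; 0, 0, c])
      (P := !![1, 0, q / (c - a); 0, 1, 0; 0, 0, 1]) (hasJordanForm_one_two _ _ _ _) ?_ ?_
    · simp [Matrix.det_fin_three]
    · ext i j
      fin_cases i <;> fin_cases j <;> simp [Matrix.mul_apply, Fin.sum_univ_three]
      field_simp
      ring

theorem hasJordanForm_of_top_block (a q r c : ℂ) :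
    HasJordanForm !![a, 1, q; 0, a, r; 0, 0, c] := by
  by_cases hc : c = a
  · subst hc
    by_cases hr : r = 0
    · subst hr
      refine HasJordanForm.of_conj (N := !![c, 1, 0; 0, c, 0; 0, 0, c])
        (P := !![1, 0, 0; 0, 1, -q; 0, 0, 1]) ?_ ?_ ?_
      · exact hasJordanForm_of_isJordan (isJordanMatrix_three (.inr ⟨rfl, rfl⟩) (.inl rfl))
      · simp [Matrix.det_fin_three]
      · ext i j
        fin_cases i <;> fin_cases j <;> simp [Matrix.mul_apply, Fin.sum_univ_three, mul_comm]
    -- The columns of `P` are the Jordan chain of the third basis vector under the nilpotent part.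
    · refine HasJordanForm.of_conj (N := !![c, 1, 0; 0, c, 1; 0, 0, c])
        (P := !![r, q, 0; 0, r, 0; 0, 0, 1]) ?_ ?_ ?_
      · exact hasJordanForm_of_isJordan
          (isJordanMatrix_three (.inr ⟨rfl, rfl⟩) (.inr ⟨rfl, rfl⟩))
      · simpa [Matrix.det_fin_three] using hr
      · ext i j
        fin_cases i <;> fin_cases j <;> simp [Matrix.mul_apply, Fin.sum_univ_three] <;> ring
  · have hca : c - a ≠ 0 := sub_ne_zero.mpr hc
    refine HasJordanForm.of_conj (N := !![a, 1, 0; 0, a, 0; 0, 0, c])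
      (P := !![1, 0, (q + r / (c - a)) / (c - a); 0, 1, r / (c - a); 0, 0, 1]) ?_ ?_ ?_
    · exact hasJordanForm_of_isJordan (isJordanMatrix_three (.inr ⟨rfl, rfl⟩) (.inl rfl))
    · simp [Matrix.det_fin_three]
    · ext i j
      fin_cases i <;> fin_cases j <;> simp [Matrix.mul_apply, Fin.sum_univ_three] <;>
        field_simp <;> ring

theorem hasJordanForm_of_upperTriangular (a p q b r c : ℂ) :
    HasJordanForm !![a, p, q; 0, b, r; 0, 0, c] := by
  by_cases hp : p = 0
  · subst hp; exact hasJordanForm_of_top_diagonal a b q r c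
  by_cases hb : b = a
  · subst hb
    refine HasJordanForm.of_conj (P := !![p, 0, 0; 0, 1, 0; 0, 0, 1])
      (hasJordanForm_of_top_block b (q / p) r c) ?_ ?_
    · simpa [Matrix.det_fin_three] using hp
    · ext i j
      fin_cases i <;> fin_cases j <;> simp [Matrix.mul_apply, Fin.sum_univ_three] <;> field_simp
  · have hba : b - a ≠ 0 := sub_ne_zero.mpr hb
    refine HasJordanForm.of_conj (P := !![1, p / (b - a), 0; 0, 1, 0; 0, 0, 1])
      (hasJordanForm_of_top_diagonal a b (q - p / (b - a) * r) r c) ?_ ?_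
    · simp [Matrix.det_fin_three]
    · ext i j
      fin_cases i <;> fin_cases j <;> simp [Matrix.mul_apply, Fin.sum_univ_three]
      all_goals field_simp
      all_goals ring

theorem exists_eigenvector {n : ℕ} [NeZero n] (M : Matrix (Fin n) (Fin n) ℂ) :
    ∃ (a : ℂ) (v : Fin n → ℂ), v ≠ 0 ∧ M.mulVec v = a • v := by
  obtain ⟨a, ha⟩ := Module.End.exists_eigenvalue (Matrix.toLin' M)
  obtain ⟨v, hv⟩ := ha.exists_hasEigenvector
  refine ⟨a, v, hv.2, ?_⟩
  rw [← Matrix.toLin'_apply]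
  exact hv.apply_eq_smul

/-- Conjugating by a matrix whose `k`-th column is an eigenvector. -/
theorem exists_conj_of_eigenvector {M P : Matrix (Fin 3) (Fin 3) ℂ} (hP : P.det ≠ 0) {a : ℂ}
    {k : Fin 3} (h : M.mulVec (P.col k) = a • P.col k) :
    ∃ N, M * P = P * N ∧ N.col k = a • Pi.single k 1 := by
  have hu : IsUnit P.det := hP.isUnit
  refine ⟨P⁻¹ * M * P, ?_, ?_⟩
  · rw [← mul_assoc, ← mul_assoc, Matrix.mul_nonsing_inv P hu, one_mul]
  · rw [← Matrix.mulVec_single_one, ← Matrix.mulVec_mulVec, ← Matrix.mulVec_mulVec,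
      Matrix.mulVec_single_one, h, Matrix.mulVec_smul, ← Matrix.mulVec_single_one,
      Matrix.mulVec_mulVec, Matrix.nonsing_inv_mul P hu, Matrix.one_mulVec]

/-- An eigenvector of `M`, and then one of the remaining `2 × 2` block, bring `M` to upper
triangular form. -/
theorem hasJordanForm (M : Matrix (Fin 3) (Fin 3) ℂ) : HasJordanForm M := by
  obtain ⟨a, v, hv, hMv⟩ := exists_eigenvector M
  obtain ⟨P, hP, hPv⟩ : ∃ P : Matrix (Fin 3) (Fin 3) ℂ, P.det ≠ 0 ∧ P.col 0 = v := by
    obtain ⟨k, hk⟩ := Function.ne_iff.mp hv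
    fin_cases k
    · exact ⟨!![v 0, 0, 0; v 1, 1, 0; v 2, 0, 1], by simpa [Matrix.det_fin_three] using hk,
        by ext i; fin_cases i <;> rfl⟩
    · exact ⟨!![v 0, 1, 0; v 1, 0, 0; v 2, 0, 1], by simpa [Matrix.det_fin_three] using hk,
        by ext i; fin_cases i <;> rfl⟩
    · exact ⟨!![v 0, 1, 0; v 1, 0, 1; v 2, 0, 0], by simpa [Matrix.det_fin_three] using hk,
        by ext i; fin_cases i <;> rfl⟩
  obtain ⟨N, hN, hN0⟩ := exists_conj_of_eigenvector hP (k := 0) (by rw [hPv, hMv])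
  refine HasJordanForm.of_conj ?_ hP hN
  have n10 : N 1 0 = 0 := by simpa using congrFun hN0 1
  have n20 : N 2 0 = 0 := by simpa using congrFun hN0 2
  obtain ⟨b, w, hw, hNw⟩ := exists_eigenvector !![N 1 1, N 1 2; N 2 1, N 2 2]
  have w0 : N 1 1 * w 0 + N 1 2 * w 1 = b * w 0 := by
    simpa [Matrix.mulVec, dotProduct, Fin.sum_univ_two] using congrFun hNw 0
  have w1 : N 2 1 * w 0 + N 2 2 * w 1 = b * w 1 := by
    simpa [Matrix.mulVec, dotProduct, Fin.sum_univ_two] using congrFun hNw 1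
  obtain ⟨s, t, hst⟩ : ∃ s t : ℂ, w 0 * t - s * w 1 ≠ 0 := by
    obtain ⟨k, hk⟩ := Function.ne_iff.mp hw
    fin_cases k
    · exact ⟨0, 1, by simpa using hk⟩
    · exact ⟨1, 0, by simpa using hk⟩
  -- `D` is the determinant of the basis `w, (s, t)`; the quotients by `D` below are Cramer's rule.
  set D := w 0 * t - s * w 1 with hD
  refine HasJordanForm.of_conj
    (N := !![N 0 0, N 0 1 * w 0 + N 0 2 * w 1, N 0 1 * s + N 0 2 * t;
      0, b, (t * (N 1 1 * s + N 1 2 * t) - s * (N 2 1 * s + N 2 2 * t)) / D;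
      0, 0, (w 0 * (N 2 1 * s + N 2 2 * t) - w 1 * (N 1 1 * s + N 1 2 * t)) / D])
    (P := !![1, 0, 0; 0, w 0, s; 0, w 1, t]) (hasJordanForm_of_upperTriangular _ _ _ _ _ _) ?_ ?_
  · simpa [Matrix.det_fin_three] using hst
  · ext i j
    fin_cases i <;> fin_cases j <;> simp [Matrix.mul_apply, Fin.sum_univ_three, n10, n20]
    · linear_combination w0
    · field_simp
      rw [hD]
      ring
    · linear_combination w1
    · field_simp
      rw [hD]
      ring

end JordanThree

/-! ### Block matrix conditions translated into Jordan form conditions. -/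

section JordanForms

variable {U : Type*} [AddCommGroup U] [Module ℝ U]

theorem isComplexJordanForm_iff {n : ℕ} (b : Module.Basis (Fin n) ℝ U) (T : Module.End ℝ U)
    (N : Matrix (Fin n) (Fin n) ℂ) :
    IsComplexJordanForm T N ↔ IsJordanMatrix N ∧
      IsSimilar ((LinearMap.toMatrix b b T).map Complex.ofRealHom) N := by
  rw [IsComplexJordanForm, exists_basis_toMatrix_iff (Algebra.TensorProduct.basis ℂ b),
    LinearMap.toMatrix_baseChange]
  rfl

theorem isComplexJordanForm_diagSix_iff (b : Module.Basis (Fin 3 ⊕ Fin 3) ℝ U)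
    (T : Module.End ℝ U) (J K : Matrix (Fin 3) (Fin 3) ℂ) :
    IsComplexJordanForm T (diagSix J K) ↔ IsJordanMatrix (diagSix J K) ∧
      IsSimilar ((LinearMap.toMatrix b b T).map Complex.ofRealHom)
        (Matrix.fromBlocks J 0 0 K) := by
  have e : (LinearMap.toMatrix (b.reindex finSumFinEquiv) (b.reindex finSumFinEquiv) T).map
      Complex.ofRealHom = Matrix.reindex (finSumFinEquiv (m := 3) (n := 3)) finSumFinEquiv
        ((LinearMap.toMatrix b b T).map Complex.ofRealHom) := by
    ext i j
    simp [LinearMap.toMatrix_apply]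
  rw [isComplexJordanForm_iff (b.reindex finSumFinEquiv), e, diagSix, isSimilar_reindex_iff]

theorem hasBlockMatrix_iff (b : Module.Basis (Fin 3 ⊕ Fin 3) ℝ U) (T : Module.End ℝ U)
    (M : Matrix (Fin 3 ⊕ Fin 3) (Fin 3 ⊕ Fin 3) ℝ) :
    HasBlockMatrix T M ↔ IsSimilar (LinearMap.toMatrix b b T) M :=
  exists_basis_toMatrix_iff b T M

theorem isJordanMatrix_diagSix {J K : Matrix (Fin 3) (Fin 3) ℂ} (hJ : IsJordanMatrix J)
    (hK : IsJordanMatrix K) : IsJordanMatrix (diagSix J K) := by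
  have e : ∀ i j, diagSix J K (finSumFinEquiv (m := 3) (n := 3) i) (finSumFinEquiv j) =
      Matrix.fromBlocks J 0 0 K i j := by
    intro i j; simp [diagSix]
  constructor
  · intro i j
    obtain ⟨i, rfl⟩ := (finSumFinEquiv (m := 3) (n := 3)).surjective i
    obtain ⟨j, rfl⟩ := (finSumFinEquiv (m := 3) (n := 3)).surjective j
    rw [e]
    rcases i with i | i <;> rcases j with j | j <;> intro h1 h2
    · exact hJ.1 i j h1 h2
    · rfl
    · rfl
    · change 3 + j.val ≠ 3 + i.val at h1
      change 3 + j.val ≠ 3 + i.val + 1 at h2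
      exact hK.1 i j (by omega) (by omega)
  · intro i j
    obtain ⟨i, rfl⟩ := (finSumFinEquiv (m := 3) (n := 3)).surjective i
    obtain ⟨j, rfl⟩ := (finSumFinEquiv (m := 3) (n := 3)).surjective j
    rw [e, e, e]
    rcases i with i | i <;> rcases j with j | j <;> intro h
    · exact hJ.2 i j h
    · exact .inl rfl
    · exact .inl rfl
    · change 3 + j.val = 3 + i.val + 1 at h
      exact hK.2 i j (by omega)

theorem IsJordanMatrix.conj {n : ℕ} {J : Matrix (Fin n) (Fin n) ℂ} (h : IsJordanMatrix J) :
    IsJordanMatrix (J.map (starRingEnd ℂ)) := by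
  refine ⟨fun i j h1 h2 => by simp [h.1 i j h1 h2], fun i j h1 => ?_⟩
  rcases h.2 i j h1 with h2 | ⟨h2, h3⟩
  · exact .inl (by simp [h2])
  · exact .inr ⟨by simp [h2], by simp [h3]⟩

/-- The real block matrix of a complex matrix `C` is similar to `diag(C, C̄)`. -/
theorem isSimilar_realBlocks (C : Matrix (Fin 3) (Fin 3) ℂ) :
    IsSimilar ((Matrix.fromBlocks (C.map Complex.re) (C.map Complex.im) (-C.map Complex.im)
      (C.map Complex.re)).map Complex.ofRealHom)
      (Matrix.fromBlocks C 0 0 (C.map (starRingEnd ℂ))) := by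
  set A : Matrix (Fin 3) (Fin 3) ℂ := (C.map Complex.re).map Complex.ofRealHom
  set B : Matrix (Fin 3) (Fin 3) ℂ := (C.map Complex.im).map Complex.ofRealHom
  have hC : C = A + Complex.I • B := by
    ext i j
    simp only [A, B, Matrix.map_apply, Matrix.add_apply, Matrix.smul_apply, smul_eq_mul,
      Complex.ofRealHom_eq_coe]
    rw [mul_comm, Complex.re_add_im]
  have hC' : C.map (starRingEnd ℂ) = A - Complex.I • B := by
    ext i j
    simp only [A, B, Matrix.map_apply, Matrix.sub_apply, Matrix.smul_apply, smul_eq_mul,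
      Complex.ofRealHom_eq_coe]
    apply Complex.ext <;> simp
  have hM : (Matrix.fromBlocks (C.map Complex.re) (C.map Complex.im) (-C.map Complex.im)
      (C.map Complex.re)).map Complex.ofRealHom = Matrix.fromBlocks A B (-B) A := by
    rw [Matrix.fromBlocks_map]
    congr 1
    ext i j
    simp [B]
  rw [hM, hC']
  nth_rewrite 1 [hC]
  -- The block columns `(1, i)` and `(1, -i)` span the subspaces on which the real block matrix acts
  -- as `C` and as its conjugate.
  refine ⟨Matrix.fromBlocks 1 1 (Complex.I • 1) (-Complex.I • 1), ?_, ?_⟩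
  · refine Matrix.isUnit_det_of_right_inverse (B := Matrix.fromBlocks ((1 / 2 : ℂ) • 1)
      ((-Complex.I / 2) • 1) ((1 / 2 : ℂ) • 1) ((Complex.I / 2) • 1)) ?_
    rw [Matrix.fromBlocks_multiply, ← Matrix.fromBlocks_one]
    congr 1 <;> simp only [one_mul, Matrix.smul_mul, smul_smul, ← add_smul]
    · norm_num
    · rw [← add_div, neg_add_cancel, zero_div, zero_smul]
    · rw [← add_mul, add_neg_cancel, zero_mul, zero_smul]
    · rw [show Complex.I * (-Complex.I / 2) + -Complex.I * (Complex.I / 2) = 1 by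
        linear_combination -Complex.I_mul_I, one_smul]
  · rw [Matrix.fromBlocks_multiply, Matrix.fromBlocks_multiply]
    congr 1
    · simp
    · simp [sub_eq_add_neg]
    · simp only [mul_one, Matrix.mul_smul, Matrix.smul_mul, one_mul, mul_zero, add_zero, smul_add,
        smul_smul, Complex.I_mul_I]
      simp [add_comm]
    · simp only [mul_one, Matrix.mul_smul, Matrix.smul_mul, one_mul, mul_zero, zero_add, smul_sub,
        smul_smul, neg_mul, Complex.I_mul_I]
      simp [sub_eq_add_neg, add_comm]

/-- Both sides say that `T` is, over `ℂ`, similar to `diag(C, C̄)` with `C` trace-free. The passage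
to a Jordan matrix changes only `C`, and the way back to a real basis is the descent of similarity.
-/
theorem complex_block_iff_jordan (hU : Module.finrank ℝ U = 6) (T : Module.End ℝ U) :
    (∃ A B : Matrix (Fin 3) (Fin 3) ℝ, A.trace = 0 ∧ B.trace = 0 ∧
      HasBlockMatrix T (Matrix.fromBlocks A B (-B) A)) ↔
    ∃ J : Matrix (Fin 3) (Fin 3) ℂ, IsJordanMatrix J ∧ J.trace = 0 ∧
      IsComplexJordanForm T (diagSix J (J.map (starRingEnd ℂ))) := by
  have : Module.Finite ℝ U := Module.finite_of_finrank_pos (by omega)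
  let b : Module.Basis (Fin 3 ⊕ Fin 3) ℝ U :=
    (Module.finBasisOfFinrankEq ℝ U hU).reindex (finSumFinEquiv (m := 3) (n := 3)).symm
  simp only [isComplexJordanForm_diagSix_iff b, hasBlockMatrix_iff b]
  constructor
  · rintro ⟨A, B, hA, hB, h⟩
    set C : Matrix (Fin 3) (Fin 3) ℂ := Matrix.of fun i j => ⟨A i j, B i j⟩ with hC
    have hCA : C.map Complex.re = A := by ext i j; rfl
    have hCB : C.map Complex.im = B := by ext i j; rfl
    obtain ⟨J, hJ, hCJ⟩ := hasJordanForm C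
    refine ⟨J, hJ, ?_, isJordanMatrix_diagSix hJ hJ.conj, ?_⟩
    · rw [← hCJ.trace_eq]
      rw [Matrix.trace_fin_three] at hA hB ⊢
      exact Complex.ext hA hB
    · have h1 := isSimilar_realBlocks C
      rw [hCA, hCB] at h1
      exact (h.map Complex.ofRealHom).trans (h1.trans (hCJ.fromBlocks (hCJ.map (starRingEnd ℂ))))
  · rintro ⟨J, hJ, htr, -, h⟩
    refine ⟨J.map Complex.re, J.map Complex.im, ?_, ?_,
      isSimilar_of_map_ofReal (h.trans (isSimilar_realBlocks J).symm)⟩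
    · have := congrArg Complex.re htr
      rw [Matrix.trace_fin_three] at this ⊢
      simpa using this
    · have := congrArg Complex.im htr
      rw [Matrix.trace_fin_three] at this ⊢
      simpa using this

theorem isComplexJordanForm_toLin'_iff {n : ℕ} (R : Matrix (Fin n) (Fin n) ℝ)
    (N : Matrix (Fin n) (Fin n) ℂ) :
    IsComplexJordanForm (Matrix.toLin' R) N ↔
      IsJordanMatrix N ∧ IsSimilar (R.map Complex.ofRealHom) N := by
  rw [isComplexJordanForm_iff (Pi.basisFun ℝ (Fin n)), ← Matrix.toLin_eq_toLin',
    LinearMap.toMatrix_toLin]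

theorem trace_eq_zero_of_map_ofReal {n : ℕ} {R : Matrix (Fin n) (Fin n) ℝ}
    {N : Matrix (Fin n) (Fin n) ℂ} (h : IsSimilar (R.map Complex.ofRealHom) N) :
    R.trace = 0 ↔ N.trace = 0 := by
  rw [← h.trace_eq, ← AddMonoidHom.map_trace, map_eq_zero]

theorem split_block_iff_jordan (hU : Module.finrank ℝ U = 6) (T : Module.End ℝ U) :
    (∃ A B : Matrix (Fin 3) (Fin 3) ℝ, A.trace = 0 ∧ B.trace = 0 ∧
      HasBlockMatrix T (Matrix.fromBlocks A 0 0 B)) ↔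
    ∃ J₁ J₂ : Matrix (Fin 3) (Fin 3) ℂ, J₁.trace = 0 ∧ J₂.trace = 0 ∧
      (∃ R₁ : Matrix (Fin 3) (Fin 3) ℝ, IsComplexJordanForm (Matrix.toLin' R₁) J₁) ∧
      (∃ R₂ : Matrix (Fin 3) (Fin 3) ℝ, IsComplexJordanForm (Matrix.toLin' R₂) J₂) ∧
      IsComplexJordanForm T (diagSix J₁ J₂) := by
  have : Module.Finite ℝ U := Module.finite_of_finrank_pos (by omega)
  let b : Module.Basis (Fin 3 ⊕ Fin 3) ℝ U :=
    (Module.finBasisOfFinrankEq ℝ U hU).reindex (finSumFinEquiv (m := 3) (n := 3)).symm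
  simp only [isComplexJordanForm_diagSix_iff b, hasBlockMatrix_iff b,
    isComplexJordanForm_toLin'_iff]
  have hmap : ∀ A B : Matrix (Fin 3) (Fin 3) ℝ,
      (Matrix.fromBlocks A 0 0 B).map Complex.ofRealHom =
        Matrix.fromBlocks (A.map Complex.ofRealHom) 0 0 (B.map Complex.ofRealHom) := by
    intro A B
    rw [Matrix.fromBlocks_map, Matrix.map_zero _ (map_zero _)]
  constructor
  · rintro ⟨A, B, hA, hB, h⟩
    obtain ⟨J₁, hJ₁, h₁⟩ := hasJordanForm (A.map Complex.ofRealHom)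
    obtain ⟨J₂, hJ₂, h₂⟩ := hasJordanForm (B.map Complex.ofRealHom)
    refine ⟨J₁, J₂, (trace_eq_zero_of_map_ofReal h₁).mp hA, (trace_eq_zero_of_map_ofReal h₂).mp hB,
      ⟨A, hJ₁, h₁⟩, ⟨B, hJ₂, h₂⟩, isJordanMatrix_diagSix hJ₁ hJ₂, ?_⟩
    refine (h.map Complex.ofRealHom).trans ?_
    rw [hmap]
    exact h₁.fromBlocks h₂
  · rintro ⟨J₁, J₂, hJ₁, hJ₂, ⟨R₁, -, h₁⟩, ⟨R₂, -, h₂⟩, -, h⟩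
    refine ⟨R₁, R₂, (trace_eq_zero_of_map_ofReal h₁).mpr hJ₁,
      (trace_eq_zero_of_map_ofReal h₂).mpr hJ₂, isSimilar_of_map_ofReal (h.trans ?_)⟩
    rw [hmap]
    exact (h₁.fromBlocks h₂).symm

end JordanForms

end CalibratedG2

theorem mainTheorem1 {𝔤 : Type*} [LieRing 𝔤] [LieAlgebra ℝ 𝔤]
    (h𝔤 : Module.finrank ℝ 𝔤 = 7) (𝔲 : LieIdeal ℝ 𝔤)
    (h𝔲 : Module.finrank ℝ 𝔲 = 6) (hab : IsLieAbelian 𝔲) :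
    -- (a)
    List.TFAE [
      ∃ φ : 𝔤 [⋀^Fin 3]→ₗ[ℝ] ℝ, CalibratedG2.IsCalibratedG2 φ,
      ∃ φ : 𝔤 [⋀^Fin 3]→ₗ[ℝ] ℝ, CalibratedG2.IsCalibratedG2Star φ ∧
        ∃ g : LinearMap.BilinForm ℝ 𝔤, CalibratedG2.IsG2StarMetric φ g ∧
          CalibratedG2.HasSignature g 𝔲.toSubmodule 2 4,
      ∀ x : 𝔤, x ∉ 𝔲 → ∃ A B : Matrix (Fin 3) (Fin 3) ℝ, A.trace = 0 ∧ B.trace = 0 ∧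
        CalibratedG2.HasBlockMatrix (LieModule.toEnd ℝ 𝔤 𝔲 x) (Matrix.fromBlocks A B (-B) A),
      ∀ x : 𝔤, x ∉ 𝔲 → ∃ J : Matrix (Fin 3) (Fin 3) ℂ,
        CalibratedG2.IsJordanMatrix J ∧ J.trace = 0 ∧
        CalibratedG2.IsComplexJordanForm (LieModule.toEnd ℝ 𝔤 𝔲 x)
          (CalibratedG2.diagSix J (J.map (starRingEnd ℂ)))] ∧
    -- (b)
    List.TFAE [
      ∃ φ : 𝔤 [⋀^Fin 3]→ₗ[ℝ] ℝ, CalibratedG2.IsCalibratedG2Star φ ∧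
        ∃ g : LinearMap.BilinForm ℝ 𝔤, CalibratedG2.IsG2StarMetric φ g ∧
          CalibratedG2.HasSignature g 𝔲.toSubmodule 3 3,
      ∀ x : 𝔤, x ∉ 𝔲 → ∃ A B : Matrix (Fin 3) (Fin 3) ℝ, A.trace = 0 ∧ B.trace = 0 ∧
        CalibratedG2.HasBlockMatrix (LieModule.toEnd ℝ 𝔤 𝔲 x) (Matrix.fromBlocks A 0 0 B),
      ∀ x : 𝔤, x ∉ 𝔲 → ∃ J₁ J₂ : Matrix (Fin 3) (Fin 3) ℂ,
        J₁.trace = 0 ∧ J₂.trace = 0 ∧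
        (∃ R₁ : Matrix (Fin 3) (Fin 3) ℝ,
          CalibratedG2.IsComplexJordanForm (Matrix.toLin' R₁) J₁) ∧
        (∃ R₂ : Matrix (Fin 3) (Fin 3) ℝ,
          CalibratedG2.IsComplexJordanForm (Matrix.toLin' R₂) J₂) ∧
        CalibratedG2.IsComplexJordanForm (LieModule.toEnd ℝ 𝔤 𝔲 x)
          (CalibratedG2.diagSix J₁ J₂)] ∧
    -- (c)
    ((∃ φ : 𝔤 [⋀^Fin 3]→ₗ[ℝ] ℝ, CalibratedG2.IsCalibratedG2Star φ ∧
        ∃ g : LinearMap.BilinForm ℝ 𝔤, CalibratedG2.IsG2StarMetric φ g ∧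
          CalibratedG2.IsDegenerate g 𝔲.toSubmodule) ↔
      ∀ x : 𝔤, x ∉ 𝔲 → ∃ A B : Matrix (Fin 3) (Fin 3) ℝ, B.trace = 0 ∧
        CalibratedG2.HasBlockMatrix (LieModule.toEnd ℝ 𝔤 𝔲 x)
          (Matrix.fromBlocks A 0 B (A - A.trace • (1 : Matrix (Fin 3) (Fin 3) ℝ)))) := by
  -- A single `x` outside `𝔲` suffices to construct the structures, whereas a given structure yields
  -- the block form for every `x`.
  obtain ⟨x, hx⟩ := CalibratedG2.exists_notMem_of_finrank h𝔤 h𝔲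
  refine ⟨?_, ?_, ?_⟩
  · tfae_have 1 → 3 := fun ⟨_, hφ⟩ y _ => CalibratedG2.complex_block_of_calibratedG2 h𝔲 hab hφ y
    tfae_have 2 → 3 := fun ⟨_, hφ, _, hg, hs⟩ y _ =>
      CalibratedG2.complex_block_of_signature h𝔲 hab hφ hg hs y
    tfae_have 3 → 1 := fun h => by
      obtain ⟨A, B, hA, hB, hM⟩ := h x hx
      exact CalibratedG2.exists_calibratedG2_of_block h𝔤 h𝔲 hab hx hA hB hM
    tfae_have 3 → 2 := fun h => by
      obtain ⟨A, B, hA, hB, hM⟩ := h x hx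
      exact CalibratedG2.exists_signature_two_four_of_block h𝔤 h𝔲 hab hx hA hB hM
    tfae_have 3 ↔ 4 := forall₂_congr fun y _ =>
      CalibratedG2.complex_block_iff_jordan h𝔲 (LieModule.toEnd ℝ 𝔤 𝔲 y)
    tfae_finish
  · tfae_have 1 → 2 := fun ⟨_, hφ, _, hg, hs⟩ y _ =>
      CalibratedG2.split_block_of_signature h𝔲 hab hφ hg hs y
    tfae_have 2 → 1 := fun h => by
      obtain ⟨A, B, hA, hB, hM⟩ := h x hx
      exact CalibratedG2.exists_signature_three_three_of_block h𝔤 h𝔲 hab hx hA hB hM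
    tfae_have 2 ↔ 3 := forall₂_congr fun y _ =>
      CalibratedG2.split_block_iff_jordan h𝔲 (LieModule.toEnd ℝ 𝔤 𝔲 y)
    tfae_finish
  · constructor
    · rintro ⟨_, hφ, _, hg, hs⟩ y _
      exact CalibratedG2.null_block_of_degenerate h𝔲 hab hφ hg hs y
    · intro h
      obtain ⟨A, B, hB, hM⟩ := h x hx
      exact CalibratedG2.exists_degenerate_of_block h𝔤 h𝔲 hab hx hB hM
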